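/- Let $p$ be a prime, let $\mathbf{C}_p$ be the completion of an algebraic closure of $\mathbf{Q}_p$, and let $K\subset \mathbf{C}_p$ be a finite extension of $\mathbf{Q}_p$ with ring of integers $\mathcal{O}_K$, uniformizer $\pi$, and residue field of cardinality $q$. Let $\{F_\alpha(T)\}_{\alpha\in\mathcal{O}_K}$ be a full family of commuting power series, that is, $F_\alpha(T)\in T\cdot\mathcal{O}_K[[T]]$ and $F_\alpha'(0)=\alpha$ for all $\alpha\in\mathcal{O}_K$; $F_\alpha\circ F_\beta=F_\beta\circ F_\alpha$ for all $\alpha,\beta\in\mathcal{O}_K$; and the Weierstrass degree of $F_\pi$ (the smallest $i$ such that the coefficient of $T^i$ in $F_\pi(T)$ is a unit of $\mathcal{O}_K$) is equal to $q$. For $n\ge 1$, let $\Lambda_n$ be the set of $u\in\mathbf{C}_p$ with $|u|<1$ such that $F_\pi^{\circ n}(u)=0$ and $F_\pi^{\circ (n-1)}(u)\neq 0$, where $F^{\circ n}$ denotes the $n$-fold iterate of $F$ under composition. Let $\Lambda_\infty=\bigcup_{n\ge1}\Lambda_n$ and $K_\infty=K(\Lambda_\infty)$. Then $K_\infty/K$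 is an abelian (Galois) extension, and it is totally ramified (every finite subextension $M/K$ has ramification index $[M:K]$). For every $g\in\mathrm{Gal}(K_\infty/K)$ there is a unique $\eta(g)\in\mathcal{O}_K^\times$ such that $g(u)=F_{\eta(g)}(u)$ for all $u\in\Lambda_\infty$. The map $\eta:\mathrm{Gal}(K_\infty/K)\to\mathcal{O}_K^\times$ is an isomorphism of topological groups (for the Krull topology and the $p$-adic topology). -/

import Mathlib

noncomputable section

namespace LubinDynamics

open scoped PowerSeries

variable (p : ℕ) [Fact p.Prime]

/-- The ring of integers `{x ∈ E : |x| ≤ 1}` of a field `E` embedded in `ℂ_[p]`, as a valuation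
subring of `E`. -/
def ringOfIntegers (E : Type*) [Field E] [Algebra E ℂ_[p]] : ValuationSubring E :=
  (NormedField.valuation (K := ℂ_[p])).valuationSubring.comap (algebraMap E ℂ_[p])

theorem mem_ringOfIntegers {E : Type*} [Field E] [Algebra E ℂ_[p]] (x : E) :
    x ∈ ringOfIntegers p E ↔ ‖algebraMap E ℂ_[p] x‖ ≤ 1 := Iff.rfl

/-- The value group `|Eˣ|` of a field `E` embedded in `ℂ_[p]`. -/
def valueGroup (E : Type*) [Field E] [Algebra E ℂ_[p]] : Subgroup ℝˣ :=
  (Units.map ((normHom : ℂ_[p] →*₀ ℝ).toMonoidHom.comp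
    (algebraMap E ℂ_[p] : E →* ℂ_[p]))).range

variable {p}
variable {K : IntermediateField ℚ_[p] ℂ_[p]}

/-- The extension `L / K` is totally ramified: for every finite subextension `M / K`, the
ramification index `(|Mˣ| : |Kˣ|)` is equal to the degree `[M : K]`. -/
def IsTotallyRamified (L : IntermediateField K ℂ_[p]) : Prop :=
  ∀ M : IntermediateField K ℂ_[p], M ≤ L → FiniteDimensional K M →
    (valueGroup p K).relIndex (valueGroup p M) = Module.finrank K M

/-- The value `f(u)` of a power series `f` over `𝓞_K` at `u ∈ ℂ_[p]` (the series converges if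
`|u| < 1`, see `hasSum_evalAt`). -/
def evalAt (f : (ringOfIntegers p K)⟦X⟧) (u : ℂ_[p]) : ℂ_[p] :=
  ∑' n : ℕ, (((PowerSeries.coeff n f : ringOfIntegers p K) : K) : ℂ_[p]) * u ^ n

theorem hasSum_evalAt (f : (ringOfIntegers p K)⟦X⟧) {u : ℂ_[p]} (hu : ‖u‖ < 1) :
    HasSum (fun n : ℕ => (((PowerSeries.coeff n f : ringOfIntegers p K) : K) : ℂ_[p]) * u ^ n) (evalAt f u) := by
  refine Summable.hasSum (NonarchimedeanAddGroup.summable_of_tendsto_cofinite_zero ?_)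
  rw [Nat.cofinite_eq_atTop]
  refine squeeze_zero_norm (fun n => ?_) (tendsto_pow_atTop_nhds_zero_of_lt_one (norm_nonneg u) hu)
  rw [norm_mul, norm_pow]
  exact mul_le_of_le_one_left (by positivity)
    ((mem_ringOfIntegers p _).1 (PowerSeries.coeff n f).2)

/-- Composition `f ∘ g` of formal power series; it is used for `g` without constant term only. -/
def comp {R : Type*} [CommRing R] (f g : R⟦X⟧) : R⟦X⟧ := PowerSeries.subst g f

/-- The `n`-fold iterate `f ∘ ⋯ ∘ f`, with value `X` for `n = 0`. -/
def iter {R : Type*} [CommRing R] (f : R⟦X⟧) : ℕ → R⟦X⟧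
  | 0 => PowerSeries.X
  | n + 1 => comp f (iter f n)

/-- The Weierstrass degree of `f` is `d`: the index `d` is the smallest one at which the coefficient
of `f` is a unit. -/
def HasWeierstrassDegree {R : Type*} [CommRing R] (f : R⟦X⟧) (d : ℕ) : Prop :=
  IsLeast {i : ℕ | IsUnit (PowerSeries.coeff i f)} d

/-- `(F_α)` is a full family of commuting power series over `𝓞_K`, with respect to the uniformizer
`π`: `F_α(T) = αT + ⋯` for all `α ∈ 𝓞_K`, any two members commute under composition, and the
Weierstrass degree of `F_π` is the cardinality of the residue field. -/
structure IsFullCommutingFamily (π : ringOfIntegers p K)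
    (F : ringOfIntegers p K → (ringOfIntegers p K)⟦X⟧) : Prop where
  constantCoeff_eq_zero : ∀ α, PowerSeries.constantCoeff (F α) = 0
  coeff_one : ∀ α, PowerSeries.coeff 1 (F α) = α
  commute : ∀ α β, comp (F α) (F β) = comp (F β) (F α)
  wideg : HasWeierstrassDegree (F π)
    (Nat.card (IsLocalRing.ResidueField (ringOfIntegers p K)))

/-- The set `Λ_n` of all `u` in the open unit disc of `ℂ_[p]` with `f^{∘n}(u) = 0` and
`f^{∘(n-1)}(u) ≠ 0`; it is used for `n ≥ 1` only. -/
def torsionLevel (f : (ringOfIntegers p K)⟦X⟧) (n : ℕ) : Set ℂ_[p] :=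
  {u | ‖u‖ < 1 ∧ evalAt (iter f n) u = 0 ∧ evalAt (iter f (n - 1)) u ≠ 0}

/-- The set `Λ_∞`, the union of all `Λ_n` with `n ≥ 1`. -/
def torsionPoints (f : (ringOfIntegers p K)⟦X⟧) : Set ℂ_[p] :=
  ⋃ n ≥ 1, torsionLevel f n

/-- The field `K_∞ = K(Λ_∞)`. -/
def torsionField (f : (ringOfIntegers p K)⟦X⟧) : IntermediateField K ℂ_[p] :=
  IntermediateField.adjoin K (torsionPoints f)

end LubinDynamics

end

noncomputable section

namespace LubinDynamics

open scoped PowerSeries IntermediateField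

variable {p : ℕ} [Fact p.Prime] {K : IntermediateField ℚ_[p] ℂ_[p]}

/-! Write f = F_π. A series commuting with f is determined by its linear coefficient, because π^m ≠
π for m ≥ 2 (`eq_of_comp_comm`). Hence F_α ∘ F_β = F_{αβ}, and the units of 𝓞_K act on each Λ_n.
This multiplicative structure suffices; no formal group law is constructed.

The quotient of f^{∘(n+1)} by f^{∘n} has constant term π and Weierstrass degree (q-1)q^n. By
Weierstrass preparation it is a unit times an Eisenstein polynomial whose roots are exactly Λ_{n+1}
(`exists_irreducible_of_levelSeries`). A point u of Λ_{n+1} thus has degree (q-1)q^n over K and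
satisfies |u|^{(q-1)q^n} = |π|, which gives total ramification.

If F_α(u) = F_β(u), then f^{∘(n+1)} divides F_α - F_β, and linear coefficients give α ≡ β mod
π^{n+1} (`pow_dvd_sub_of_evalAt_eq`). There are (q-1)q^n unit classes modulo π^{n+1}, as many as the
degree allows roots, so these classes act simply transitively on Λ_{n+1} (`exists_representatives`,
`evalAt_eq_iff_pow_dvd_sub`).

A Galois automorphism g preserves the absolute value, hence commutes with evaluation
(`coe_algEquiv_evalAt`). On the levels up to n+1 it therefore acts as a single F_{α_n}, and the α_n
converge to η(g). Injectivity of η holds because Λ_∞ generates K_∞; surjectivity because the image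
is dense, by irreducibility at each level, and compact. -/

/-! ### Evaluation of power series on the open unit disc -/

/-- The inclusion of `𝓞_K` into `ℂ_[p]`. -/
def integerEmbedding (K : IntermediateField ℚ_[p] ℂ_[p]) : ringOfIntegers p K →+* ℂ_[p] :=
  (algebraMap K ℂ_[p]).comp (ringOfIntegers p K).subtype

theorem integerEmbedding_apply (a : ringOfIntegers p K) :
    integerEmbedding K a = ((a : K) : ℂ_[p]) := rfl

theorem integerEmbedding_injective : Function.Injective (integerEmbedding K) :=
  (algebraMap K ℂ_[p]).injective.comp Subtype.val_injective

theorem norm_integerEmbedding_le_one (a : ringOfIntegers p K) : ‖integerEmbedding K a‖ ≤ 1 :=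
  (mem_ringOfIntegers p _).1 a.2

theorem norm_term_le (f : (ringOfIntegers p K)⟦X⟧) (u : ℂ_[p]) (n : ℕ) :
    ‖integerEmbedding K (PowerSeries.coeff n f) * u ^ n‖ ≤ ‖u‖ ^ n := by
  rw [norm_mul, norm_pow]
  exact mul_le_of_le_one_left (by positivity) (norm_integerEmbedding_le_one _)

theorem hasSum_evalAt' (f : (ringOfIntegers p K)⟦X⟧) {u : ℂ_[p]} (hu : ‖u‖ < 1) :
    HasSum (fun n : ℕ => integerEmbedding K (PowerSeries.coeff n f) * u ^ n) (evalAt f u) :=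
  hasSum_evalAt f hu

theorem summable_norm_term (f : (ringOfIntegers p K)⟦X⟧) {u : ℂ_[p]} (hu : ‖u‖ < 1) :
    Summable fun n : ℕ => ‖integerEmbedding K (PowerSeries.coeff n f) * u ^ n‖ :=
  Summable.of_nonneg_of_le (fun _ => norm_nonneg _) (norm_term_le f u)
    (summable_geometric_of_lt_one (norm_nonneg u) hu)

theorem evalAt_coe (P : Polynomial (ringOfIntegers p K)) (u : ℂ_[p]) :
    evalAt (P : (ringOfIntegers p K)⟦X⟧) u = P.eval₂ (integerEmbedding K) u := by
  rw [Polynomial.eval₂_eq_sum_range]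
  refine (tsum_eq_sum (s := Finset.range (P.natDegree + 1)) fun n hn => ?_).trans ?_
  · rw [Polynomial.coeff_coe, Polynomial.coeff_eq_zero_of_natDegree_lt (by simpa using hn)]
    simp
  · simp only [Polynomial.coeff_coe]; rfl

/-- Evaluation of power series over `𝓞_K` at a point of the open unit disc. -/
def evalHom {u : ℂ_[p]} (hu : ‖u‖ < 1) : (ringOfIntegers p K)⟦X⟧ →+* ℂ_[p] where
  toFun f := evalAt f u
  map_one' := by simpa using evalAt_coe (K := K) 1 u
  map_zero' := by simpa using evalAt_coe (K := K) 0 u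
  map_add' f g := by
    refine (hasSum_evalAt' (f + g) hu).unique ?_
    simpa only [map_add, add_mul] using (hasSum_evalAt' f hu).add (hasSum_evalAt' g hu)
  map_mul' f g := by
    change evalAt (f * g) u = (∑' n, integerEmbedding K (PowerSeries.coeff n f) * u ^ n) *
      (∑' n, integerEmbedding K (PowerSeries.coeff n g) * u ^ n)
    rw [tsum_mul_tsum_eq_tsum_sum_antidiagonal_of_summable_norm (summable_norm_term f hu)
      (summable_norm_term g hu)]
    refine tsum_congr fun n => ?_
    change integerEmbedding K (PowerSeries.coeff n (f * g)) * u ^ n = _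
    rw [PowerSeries.coeff_mul, map_sum, Finset.sum_mul]
    refine Finset.sum_congr rfl fun x hx => ?_
    rw [map_mul, ← Finset.HasAntidiagonal.mem_antidiagonal.1 hx, pow_add]
    ring

theorem evalHom_apply {u : ℂ_[p]} (hu : ‖u‖ < 1) (f : (ringOfIntegers p K)⟦X⟧) :
    evalHom hu f = evalAt f u := rfl

theorem evalAt_mul (f g : (ringOfIntegers p K)⟦X⟧) {u : ℂ_[p]} (hu : ‖u‖ < 1) :
    evalAt (f * g) u = evalAt f u * evalAt g u := map_mul (evalHom hu) f g

theorem evalAt_add (f g : (ringOfIntegers p K)⟦X⟧) {u : ℂ_[p]} (hu : ‖u‖ < 1) :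
    evalAt (f + g) u = evalAt f u + evalAt g u := map_add (evalHom hu) f g

theorem evalAt_sub (f g : (ringOfIntegers p K)⟦X⟧) {u : ℂ_[p]} (hu : ‖u‖ < 1) :
    evalAt (f - g) u = evalAt f u - evalAt g u := map_sub (evalHom hu) f g

theorem evalAt_X (u : ℂ_[p]) : evalAt (PowerSeries.X : (ringOfIntegers p K)⟦X⟧) u = u := by
  simpa using evalAt_coe (K := K) Polynomial.X u

theorem evalAt_ne_zero_of_isUnit {f : (ringOfIntegers p K)⟦X⟧} (hf : IsUnit f) {u : ℂ_[p]}
    (hu : ‖u‖ < 1) : evalAt f u ≠ 0 :=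
  (hf.map (evalHom hu)).ne_zero

theorem norm_evalAt_le_one (f : (ringOfIntegers p K)⟦X⟧) {u : ℂ_[p]} (hu : ‖u‖ < 1) :
    ‖evalAt f u‖ ≤ 1 := by
  refine (IsUltrametricDist.norm_tsum_le_of_forall_le_of_nonneg zero_le_one fun n => ?_)
  exact (norm_term_le f u n).trans (pow_le_one₀ (norm_nonneg _) hu.le)

theorem norm_evalAt_le (f : (ringOfIntegers p K)⟦X⟧) (hf : PowerSeries.constantCoeff f = 0)
    {u : ℂ_[p]} (hu : ‖u‖ < 1) : ‖evalAt f u‖ ≤ ‖u‖ := by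
  obtain ⟨g, rfl⟩ := PowerSeries.X_dvd_iff.2 hf
  rw [evalAt_mul _ _ hu, evalAt_X, norm_mul]
  exact mul_le_of_le_one_right (norm_nonneg _) (norm_evalAt_le_one g hu)

theorem norm_evalAt_lt_one (f : (ringOfIntegers p K)⟦X⟧) (hf : PowerSeries.constantCoeff f = 0)
    {u : ℂ_[p]} (hu : ‖u‖ < 1) : ‖evalAt f u‖ < 1 :=
  (norm_evalAt_le f hf hu).trans_lt hu

theorem evalAt_zero_right {f : (ringOfIntegers p K)⟦X⟧} (hf : PowerSeries.constantCoeff f = 0) :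
    evalAt f 0 = 0 := by
  simpa using norm_evalAt_le f hf (u := 0) (by simp)

/-! ### Formal composition -/

section Comp

variable {R : Type*} [CommRing R]

theorem hasSubst_of_constantCoeff {g : R⟦X⟧} (hg : PowerSeries.constantCoeff g = 0) :
    PowerSeries.HasSubst g := PowerSeries.HasSubst.of_constantCoeff_zero' hg

theorem comp_mul (f₁ f₂ : R⟦X⟧) {g : R⟦X⟧} (hg : PowerSeries.constantCoeff g = 0) :
    comp (f₁ * f₂) g = comp f₁ g * comp f₂ g :=
  PowerSeries.subst_mul (hasSubst_of_constantCoeff hg) _ _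

theorem comp_add (f₁ f₂ : R⟦X⟧) {g : R⟦X⟧} (hg : PowerSeries.constantCoeff g = 0) :
    comp (f₁ + f₂) g = comp f₁ g + comp f₂ g :=
  PowerSeries.subst_add (hasSubst_of_constantCoeff hg) _ _

theorem comp_sub (f₁ f₂ : R⟦X⟧) {g : R⟦X⟧} (hg : PowerSeries.constantCoeff g = 0) :
    comp (f₁ - f₂) g = comp f₁ g - comp f₂ g :=
  PowerSeries.subst_sub (hasSubst_of_constantCoeff hg) _ _

theorem comp_pow (f : R⟦X⟧) {g : R⟦X⟧} (hg : PowerSeries.constantCoeff g = 0) (n : ℕ) :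
    comp (f ^ n) g = comp f g ^ n :=
  PowerSeries.subst_pow (hasSubst_of_constantCoeff hg) _ _

theorem X_comp {g : R⟦X⟧} (hg : PowerSeries.constantCoeff g = 0) :
    comp PowerSeries.X g = g :=
  PowerSeries.subst_X (hasSubst_of_constantCoeff hg)

theorem comp_X (f : R⟦X⟧) : comp f PowerSeries.X = f := PowerSeries.X_subst f

theorem comp_C (a : R) (g : R⟦X⟧) : comp (PowerSeries.C a) g = PowerSeries.C a :=
  PowerSeries.subst_C a

theorem coe_comp (P : Polynomial R) {g : R⟦X⟧} (hg : PowerSeries.constantCoeff g = 0) :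
    comp (P : R⟦X⟧) g = Polynomial.aeval g P :=
  PowerSeries.subst_coe (hasSubst_of_constantCoeff hg) P

theorem comp_assoc (f : R⟦X⟧) {g h : R⟦X⟧} (hg : PowerSeries.constantCoeff g = 0)
    (hh : PowerSeries.constantCoeff h = 0) : comp (comp f g) h = comp f (comp g h) :=
  PowerSeries.subst_comp_subst_apply (hasSubst_of_constantCoeff hg)
    (hasSubst_of_constantCoeff hh) f

theorem constantCoeff_comp (f : R⟦X⟧) {g : R⟦X⟧} (hg : PowerSeries.constantCoeff g = 0) :
    PowerSeries.constantCoeff (comp f g) = PowerSeries.constantCoeff f := by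
  obtain ⟨h, hh⟩ := PowerSeries.X_dvd_iff.2
    (show PowerSeries.constantCoeff (f - PowerSeries.C (PowerSeries.constantCoeff f)) = 0 by simp)
  rw [sub_eq_iff_eq_add] at hh
  conv_lhs => rw [hh, comp_add _ _ hg, comp_mul _ _ hg, X_comp hg, comp_C]
  simp [hg]

theorem coeff_one_X_mul (r : R⟦X⟧) :
    PowerSeries.coeff 1 (PowerSeries.X * r) = PowerSeries.constantCoeff r := by
  simp

theorem coeff_one_comp {f g : R⟦X⟧} (hf : PowerSeries.constantCoeff f = 0)
    (hg : PowerSeries.constantCoeff g = 0) : PowerSeries.coeff 1 (comp f g) =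
      PowerSeries.coeff 1 f * PowerSeries.coeff 1 g := by
  obtain ⟨h, rfl⟩ := PowerSeries.X_dvd_iff.2 hf
  obtain ⟨k, rfl⟩ := PowerSeries.X_dvd_iff.2 hg
  rw [comp_mul _ _ hg, X_comp hg, mul_assoc, coeff_one_X_mul, coeff_one_X_mul, coeff_one_X_mul,
    map_mul, constantCoeff_comp _ hg,
    mul_comm]

theorem map_comp {S : Type*} [CommRing S] (φ : R →+* S) (f : R⟦X⟧) {g : R⟦X⟧}
    (hg : PowerSeries.constantCoeff g = 0) :
    PowerSeries.map φ (comp f g) = comp (PowerSeries.map φ f) (PowerSeries.map φ g) :=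
  PowerSeries.map_subst (hasSubst_of_constantCoeff hg) f

theorem constantCoeff_iter {f : R⟦X⟧} (hf : PowerSeries.constantCoeff f = 0) (n : ℕ) :
    PowerSeries.constantCoeff (iter f n) = 0 := by
  induction n with
  | zero => simp [iter]
  | succ n ih => rw [iter, constantCoeff_comp _ ih, hf]

end Comp

/-- The identity is polynomial for the truncation of `f` at degree `n`; the tails contribute `v ^ n`
times an element of norm at most 1, and `n` is arbitrary. -/
theorem evalAt_comp (f : (ringOfIntegers p K)⟦X⟧) {g : (ringOfIntegers p K)⟦X⟧}
    (hg : PowerSeries.constantCoeff g = 0) {u : ℂ_[p]} (hu : ‖u‖ < 1) :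
    evalAt (comp f g) u = evalAt f (evalAt g u) := by
  set v := evalAt g u
  have hv : ‖v‖ < 1 := norm_evalAt_lt_one g hg hu
  have key : ∀ n : ℕ, ‖evalAt (comp f g) u - evalAt f v‖ ≤ ‖v‖ ^ n := fun n => by
    have h := f.eq_X_pow_mul_shift_add_trunc n
    set P := f.trunc n
    set r : (ringOfIntegers p K)⟦X⟧ := PowerSeries.mk fun i => PowerSeries.coeff (i + n) f
    have e₁ : evalAt (comp (P : (ringOfIntegers p K)⟦X⟧) g) u =
        evalAt (P : (ringOfIntegers p K)⟦X⟧) v := by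
      rw [coe_comp _ hg, evalAt_coe, ← evalHom_apply hu, Polynomial.aeval_def,
        Polynomial.hom_eval₂]
      congr 1
      ext a
      have := evalAt_coe (K := K) (Polynomial.C a) u
      simpa [evalHom_apply] using this
    have e₂ : evalAt (comp f g) u - evalAt f v = v ^ n * (evalAt (comp r g) u - evalAt r v) := by
      rw [h, comp_add _ _ hg, comp_mul _ _ hg, comp_pow _ hg, X_comp hg, evalAt_add _ _ hu,
        evalAt_add _ _ hv, e₁, evalAt_mul _ _ hu, evalAt_mul _ _ hv, ← evalHom_apply hu (g ^ n),
        ← evalHom_apply hv (PowerSeries.X ^ n), map_pow, map_pow, evalHom_apply, evalHom_apply,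
        evalAt_X]
      ring
    rw [e₂, norm_mul, norm_pow]
    refine mul_le_of_le_one_right (by positivity) ?_
    rw [sub_eq_add_neg]
    refine (IsUltrametricDist.norm_add_le_max _ _).trans (max_le (norm_evalAt_le_one _ hu) ?_)
    rw [norm_neg]
    exact norm_evalAt_le_one _ hv
  have := ge_of_tendsto' (tendsto_pow_atTop_nhds_zero_of_lt_one (norm_nonneg v) hv) key
  rwa [norm_le_zero_iff, sub_eq_zero] at this

theorem evalAt_iter_add {f : (ringOfIntegers p K)⟦X⟧} (hf : PowerSeries.constantCoeff f = 0)
    (m n : ℕ) {u : ℂ_[p]} (hu : ‖u‖ < 1) :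
    evalAt (iter f (m + n)) u = evalAt (iter f m) (evalAt (iter f n) u) := by
  induction m with
  | zero => rw [zero_add, iter, evalAt_X]
  | succ m ih =>
    rw [Nat.succ_add, iter, iter, evalAt_comp _ (constantCoeff_iter hf _) hu, ih,
      evalAt_comp _ (constantCoeff_iter hf _)
        (norm_evalAt_lt_one _ (constantCoeff_iter hf _) hu)]

/-! ### Rigidity of commuting power series -/

section Commuting

variable {R : Type*} [CommRing R]

/-- For the truncation of `k` at degree `m`, this is divisibility of P(G) - P(H) by G - H; the tail
only contributes multiples of `G ^ m` and `H ^ m`. -/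
theorem X_pow_dvd_comp_sub_comp (k : R⟦X⟧) {G H : R⟦X⟧} (hG : PowerSeries.constantCoeff G = 0)
    (hH : PowerSeries.constantCoeff H = 0) {m : ℕ} (h : PowerSeries.X ^ m ∣ G - H) :
    PowerSeries.X ^ m ∣ comp k G - comp k H := by
  have hk := k.eq_X_pow_mul_shift_add_trunc m
  set P := k.trunc m
  set r : R⟦X⟧ := PowerSeries.mk fun i => PowerSeries.coeff (i + m) k
  have hP : G - H ∣ Polynomial.aeval G P - Polynomial.aeval H P := by
    rw [← Polynomial.eval_map_algebraMap, ← Polynomial.eval_map_algebraMap]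
    exact Polynomial.sub_dvd_eval_sub G H (P.map (algebraMap R R⟦X⟧))
  rw [hk, comp_add _ _ hG, comp_add _ _ hH, comp_mul _ _ hG, comp_mul _ _ hH, comp_pow _ hG,
    comp_pow _ hH, X_comp hG, X_comp hH, coe_comp _ hG, coe_comp _ hH, add_sub_add_comm]
  exact dvd_add (dvd_sub (dvd_mul_of_dvd_left (pow_dvd_pow_of_dvd (PowerSeries.X_dvd_iff.2 hG) m) _)
    (dvd_mul_of_dvd_left (pow_dvd_pow_of_dvd (PowerSeries.X_dvd_iff.2 hH) m) _)) (h.trans hP)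

/-- Let λ be the linear coefficient of `f`, and suppose G - H = d₀ X^m + ⋯ with m ≥ 2. The degree
`m` coefficient of G∘f - H∘f is λ^m d₀ and that of f∘G - f∘H is λ d₀, so λ^m ≠ λ forces d₀ = 0. -/
theorem eq_of_comp_comm [IsDomain R] {f G H : R⟦X⟧} (hf : PowerSeries.constantCoeff f = 0)
    (hf₁ : ∀ m ≥ 2, PowerSeries.coeff 1 f ^ m ≠ PowerSeries.coeff 1 f)
    (hG : PowerSeries.constantCoeff G = 0) (hH : PowerSeries.constantCoeff H = 0)
    (hGH : PowerSeries.coeff 1 G = PowerSeries.coeff 1 H)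
    (hfG : comp f G = comp G f) (hfH : comp f H = comp H f) : G = H := by
  suffices h : ∀ m, PowerSeries.X ^ m ∣ G - H by
    ext n
    have := PowerSeries.X_pow_dvd_iff.1 (h (n + 1)) n n.lt_succ_self
    rwa [map_sub, sub_eq_zero] at this
  have h2 : PowerSeries.X ^ 2 ∣ G - H := by
    rw [PowerSeries.X_pow_dvd_iff]
    intro m hm
    interval_cases m <;> simp [hG, hH, hGH]
  intro m
  induction m with
  | zero => simp
  | succ m ih =>
    rcases lt_or_ge m 2 with hm | hm
    · exact (pow_dvd_pow _ (by omega)).trans h2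
    obtain ⟨d, hd⟩ := ih
    obtain ⟨f', rfl⟩ := PowerSeries.X_dvd_iff.2 hf
    have e₁ : comp G (PowerSeries.X * f') - comp H (PowerSeries.X * f') =
        PowerSeries.X ^ m * (f' ^ m * comp d (PowerSeries.X * f')) := by
      rw [← comp_sub _ _ hf, hd, comp_mul _ _ hf, comp_pow _ hf, X_comp hf]
      ring
    have e₂ : comp (PowerSeries.X * f') G - comp (PowerSeries.X * f') H =
        PowerSeries.X ^ m * (d * comp f' G) + H * (comp f' G - comp f' H) := by
      rw [comp_mul _ _ hG, comp_mul _ _ hH, X_comp hG, X_comp hH, ← mul_assoc, ← hd]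
      ring
    obtain ⟨h', rfl⟩ := PowerSeries.X_dvd_iff.2 hH
    obtain ⟨k, hk⟩ := X_pow_dvd_comp_sub_comp f' hG hH ⟨d, hd⟩
    rw [hfG, hfH, e₁, hk] at e₂
    have e₃ := congrArg (PowerSeries.coeff m) e₂
    -- The factor `X` of `H` pushes the term with `f'∘G - f'∘H` past degree `m`.
    rw [show PowerSeries.X * h' * (PowerSeries.X ^ m * k) =
        PowerSeries.X ^ m * (PowerSeries.X * (h' * k)) by ring,
      ← mul_add] at e₃
    have hm0 (r : R⟦X⟧) : PowerSeries.coeff m (PowerSeries.X ^ m * r) =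
        PowerSeries.constantCoeff r := by
      simp [PowerSeries.coeff_X_pow_mul']
    rw [hm0, hm0] at e₃
    simp only [map_mul, map_pow, map_add, constantCoeff_comp _ hf, constantCoeff_comp _ hG,
      PowerSeries.constantCoeff_X, zero_mul, add_zero] at e₃
    have hd0 : PowerSeries.constantCoeff d = 0 := by
      by_contra hne
      rw [mul_comm] at e₃
      exact hf₁ m hm (by rw [coeff_one_X_mul]; exact mul_left_cancel₀ hne e₃)
    obtain ⟨d', rfl⟩ := PowerSeries.X_dvd_iff.2 hd0
    exact ⟨d', by rw [hd, pow_succ, mul_assoc]⟩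

end Commuting

/-! ### Arithmetic of the ring of integers -/

section Integers

theorem isUnit_iff_norm_eq_one (a : ringOfIntegers p K) :
    IsUnit a ↔ ‖integerEmbedding K a‖ = 1 := by
  constructor
  · rintro ⟨a, rfl⟩
    refine le_antisymm (norm_integerEmbedding_le_one _) ?_
    have h : ‖integerEmbedding K (a : ringOfIntegers p K)‖ *
        ‖integerEmbedding K ((a⁻¹ : (ringOfIntegers p K)ˣ) : ringOfIntegers p K)‖ = 1 := by
      rw [← norm_mul, ← map_mul, Units.mul_inv, map_one, norm_one]
    rw [← h]
    exact mul_le_of_le_one_right (norm_nonneg _) (norm_integerEmbedding_le_one _)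
  · intro h
    have h0 : (a : K) ≠ 0 := by
      rintro h0
      rw [integerEmbedding_apply, h0] at h
      simp at h
    have hmem : (a : K)⁻¹ ∈ ringOfIntegers p K := by
      rw [mem_ringOfIntegers, map_inv₀, norm_inv]
      exact (inv_eq_one.2 h).le
    exact IsUnit.of_mul_eq_one ⟨_, hmem⟩ (Subtype.ext (mul_inv_cancel₀ h0))

theorem dvd_of_norm_le {a b : ringOfIntegers p K}
    (h : ‖integerEmbedding K a‖ ≤ ‖integerEmbedding K b‖) : b ∣ a := by
  by_cases hb : b = 0
  · subst hb
    rw [map_zero, norm_zero, norm_le_zero_iff, map_eq_zero_iff _ integerEmbedding_injective] at h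
    rw [h]
  have hb' : (b : K) ≠ 0 := fun h => hb (Subtype.ext h)
  have hmem : (a : K) / b ∈ ringOfIntegers p K := by
    rw [mem_ringOfIntegers, map_div₀, norm_div]
    exact div_le_one_of_le₀ h (norm_nonneg _)
  exact ⟨⟨_, hmem⟩, Subtype.ext (mul_div_cancel₀ _ hb').symm⟩

theorem norm_le_of_dvd {a b : ringOfIntegers p K} (h : b ∣ a) :
    ‖integerEmbedding K a‖ ≤ ‖integerEmbedding K b‖ := by
  obtain ⟨c, rfl⟩ := h
  rw [map_mul, norm_mul]
  exact mul_le_of_le_one_right (norm_nonneg _) (norm_integerEmbedding_le_one _)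

variable {π : ringOfIntegers p K}

theorem norm_uniformizer_pos (hπ : Irreducible π) : 0 < ‖integerEmbedding K π‖ :=
  norm_pos_iff.2 fun h => hπ.ne_zero (integerEmbedding_injective (h.trans (map_zero _).symm))

theorem norm_uniformizer_lt_one (hπ : Irreducible π) : ‖integerEmbedding K π‖ < 1 :=
  (norm_integerEmbedding_le_one π).lt_of_ne fun h => hπ.not_isUnit ((isUnit_iff_norm_eq_one π).2 h)

/-- Norms are comparable: if |π| ≤ |a|, then π = ac, and irreducibility makes c a unit. -/
theorem dvd_of_not_isUnit (hπ : Irreducible π) {a : ringOfIntegers p K} (ha : ¬ IsUnit a) :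
    π ∣ a := by
  rcases le_total ‖integerEmbedding K a‖ ‖integerEmbedding K π‖ with h | h
  · exact dvd_of_norm_le h
  · obtain ⟨c, hc⟩ := dvd_of_norm_le h
    obtain ⟨c, rfl⟩ := (hπ.isUnit_or_isUnit hc).resolve_left ha
    exact ⟨(c⁻¹ : (ringOfIntegers p K)ˣ), by rw [hc]; simp⟩

theorem maximalIdeal_eq_span (hπ : Irreducible π) :
    IsLocalRing.maximalIdeal (ringOfIntegers p K) = Ideal.span {π} := by
  ext a
  rw [IsLocalRing.mem_maximalIdeal, mem_nonunits_iff, Ideal.mem_span_singleton]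
  exact ⟨dvd_of_not_isUnit hπ, fun h ha => hπ.not_isUnit (isUnit_of_dvd_unit h ha)⟩

theorem mem_maximalIdeal_pow_iff_dvd (hπ : Irreducible π) (a : ringOfIntegers p K) (n : ℕ) :
    a ∈ IsLocalRing.maximalIdeal (ringOfIntegers p K) ^ n ↔ π ^ n ∣ a := by
  rw [maximalIdeal_eq_span hπ, Ideal.span_singleton_pow, Ideal.mem_span_singleton]

theorem pow_dvd_iff_norm_le (a : ringOfIntegers p K) (n : ℕ) :
    π ^ n ∣ a ↔ ‖integerEmbedding K a‖ ≤ ‖integerEmbedding K π‖ ^ n := by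
  rw [← norm_pow, ← map_pow]
  exact ⟨norm_le_of_dvd, dvd_of_norm_le⟩

theorem eq_zero_of_forall_pow_dvd (hπ : Irreducible π) {a : ringOfIntegers p K}
    (h : ∀ n, π ^ n ∣ a) : a = 0 := by
  refine integerEmbedding_injective ((norm_le_zero_iff.1 ?_).trans (map_zero _).symm)
  exact ge_of_tendsto' (tendsto_pow_atTop_nhds_zero_of_lt_one (norm_nonneg _)
    (norm_uniformizer_lt_one hπ)) fun n => (pow_dvd_iff_norm_le a n).1 (h n)

theorem exists_eq_pow_mul_unit (hπ : Irreducible π) {a : ringOfIntegers p K} (ha : a ≠ 0) :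
    ∃ (n : ℕ) (u : (ringOfIntegers p K)ˣ), a = π ^ n * u := by
  have hfin : ∃ n, ¬ π ^ (n + 1) ∣ a := by
    by_contra! h
    refine ha (eq_zero_of_forall_pow_dvd hπ fun n => ?_)
    exact (pow_dvd_pow π n.le_succ).trans (h n)
  classical
  have hlt : π ^ Nat.find hfin ∣ a := by
    rcases h : Nat.find hfin with _ | n
    · simp
    · exact not_not.1 (Nat.find_min hfin (m := n) (by omega))
  obtain ⟨c, hc⟩ := hlt
  refine ⟨Nat.find hfin, (show IsUnit c from ?_).unit, hc⟩
  by_contra hcu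
  obtain ⟨d, rfl⟩ := dvd_of_not_isUnit hπ hcu
  exact Nat.find_spec hfin ⟨d, by rw [pow_succ, mul_assoc]; exact hc⟩

theorem exists_norm_eq_zpow (hπ : Irreducible π) {x : K} (hx : x ≠ 0) :
    ∃ n : ℤ, ‖(x : ℂ_[p])‖ = ‖integerEmbedding K π‖ ^ n := by
  have key : ∀ y : K, y ≠ 0 → ‖(y : ℂ_[p])‖ ≤ 1 →
      ∃ n : ℕ, ‖(y : ℂ_[p])‖ = ‖integerEmbedding K π‖ ^ n := fun y hy hy1 => by
    obtain ⟨n, u, h⟩ := exists_eq_pow_mul_unit hπ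
      (a := ⟨y, (mem_ringOfIntegers p y).2 hy1⟩) (fun h => hy (congrArg Subtype.val h))
    refine ⟨n, ?_⟩
    change ‖integerEmbedding K ⟨y, (mem_ringOfIntegers p y).2 hy1⟩‖ = _
    rw [h, map_mul, norm_mul, (isUnit_iff_norm_eq_one _).1 u.isUnit, mul_one, map_pow, norm_pow]
  rcases le_total ‖(x : ℂ_[p])‖ 1 with h | h
  · obtain ⟨n, hn⟩ := key x hx h
    exact ⟨n, by rw [hn, zpow_natCast]⟩
  · obtain ⟨n, hn⟩ := key x⁻¹ (inv_ne_zero hx) (by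
      simpa using inv_le_one_of_one_le₀ h)
    refine ⟨-n, ?_⟩
    rw [zpow_neg, zpow_natCast, ← hn]
    simp

theorem isClosed_of_finiteDimensional [FiniteDimensional ℚ_[p] K] :
    IsClosed (K : Set ℂ_[p]) :=
  Submodule.closed_of_finiteDimensional (Subalgebra.toSubmodule K.toSubalgebra)

/-- Limits exist in `ℂ_[p]` and stay in `K`, which is closed because it is finite-dimensional over
`ℚ_[p]`. Completeness is what Weierstrass preparation and division require. -/
theorem isAdicComplete_ringOfIntegers [FiniteDimensional ℚ_[p] K] (hπ : Irreducible π) :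
    IsAdicComplete (IsLocalRing.maximalIdeal (ringOfIntegers p K)) (ringOfIntegers p K) where
  haus' a ha := eq_zero_of_forall_pow_dvd hπ fun n => by
    have := ha n
    rwa [SModEq.zero, smul_eq_mul, Ideal.mul_top, mem_maximalIdeal_pow_iff_dvd hπ] at this
  prec' f hf := by
    have hf' : ∀ {m n : ℕ}, m ≤ n → ‖integerEmbedding K (f m) - integerEmbedding K (f n)‖ ≤
        ‖integerEmbedding K π‖ ^ m := fun {m n} hmn => by
      have := hf hmn
      rwa [SModEq.sub_mem, smul_eq_mul, Ideal.mul_top, mem_maximalIdeal_pow_iff_dvd hπ,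
        pow_dvd_iff_norm_le, map_sub] at this
    have hlim := tendsto_pow_atTop_nhds_zero_of_lt_one (norm_nonneg _) (norm_uniformizer_lt_one hπ)
    have hc : CauchySeq fun n => integerEmbedding K (f n) :=
      cauchySeq_of_le_tendsto_0' _ (fun m n hmn => by rw [dist_eq_norm]; exact hf' hmn) hlim
    obtain ⟨x, hx⟩ := cauchySeq_tendsto_of_complete hc
    have hxK : x ∈ K := isClosed_of_finiteDimensional.mem_of_tendsto hx
      (Filter.Eventually.of_forall fun n => (f n : K).2)
    have hx1 : ‖x‖ ≤ 1 := le_of_tendsto' hx.norm fun n => norm_integerEmbedding_le_one _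
    refine ⟨⟨⟨x, hxK⟩, (mem_ringOfIntegers p _).2 hx1⟩, fun n => ?_⟩
    rw [SModEq.sub_mem, smul_eq_mul, Ideal.mul_top, mem_maximalIdeal_pow_iff_dvd hπ,
      pow_dvd_iff_norm_le, map_sub]
    exact le_of_tendsto ((tendsto_const_nhds.sub hx).norm)
      (Filter.eventually_atTop.2 ⟨n, fun m hm => hf' hm⟩)

/-- Representatives of the units modulo `π ^ n`. -/
theorem exists_units_pairwise_incongruent (hπ : Irreducible π) {q : ℕ} (hq : q ≠ 0)
    (hcard : Nat.card (IsLocalRing.ResidueField (ringOfIntegers p K)) = q) (n : ℕ) :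
    ∃ T : Finset (ringOfIntegers p K), T.card = (q - 1) * q ^ n ∧ (∀ a ∈ T, IsUnit a) ∧
      ∀ a ∈ T, ∀ b ∈ T, π ^ (n + 1) ∣ a - b → a = b := by
  classical
  set k := IsLocalRing.ResidueField (ringOfIntegers p K)
  have : Finite k := Nat.finite_of_card_ne_zero (by rwa [hcard])
  have := Fintype.ofFinite k
  rw [Nat.card_eq_fintype_card] at hcard
  obtain ⟨s, hs⟩ := (IsLocalRing.residue_surjective (R := ringOfIntegers p K)).hasRightInverse
  have hres : ∀ a b : ringOfIntegers p K, π ∣ a - b →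
      IsLocalRing.residue _ a = IsLocalRing.residue _ b := fun a b h => by
    rw [← sub_eq_zero, ← map_sub, IsLocalRing.residue_eq_zero_iff, maximalIdeal_eq_span hπ,
      Ideal.mem_span_singleton]
    exact h
  induction n with
  | zero =>
    refine ⟨(Finset.univ.erase (0 : k)).image s, ?_, ?_, ?_⟩
    · rw [Finset.card_image_of_injective _ hs.injective,
        Finset.card_erase_of_mem (Finset.mem_univ _),
        Finset.card_univ, hcard, pow_zero, mul_one]
    · intro a ha
      obtain ⟨x, hx, rfl⟩ := Finset.mem_image.1 ha
      rw [← IsLocalRing.residue_ne_zero_iff_isUnit, hs x]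
      exact Finset.ne_of_mem_erase hx
    · intro a ha b hb h
      obtain ⟨x, hx, rfl⟩ := Finset.mem_image.1 ha
      obtain ⟨y, hy, rfl⟩ := Finset.mem_image.1 hb
      have := hres _ _ (by simpa using h)
      rw [hs, hs] at this
      rw [this]
  | succ n ih =>
    obtain ⟨T, hT, hTu, hTi⟩ := ih
    have hinj : ∀ t ∈ T, ∀ t' ∈ T, ∀ x y : k,
        π ^ (n + 1 + 1) ∣ (t + π ^ (n + 1) * s x) - (t' + π ^ (n + 1) * s y) → t = t' ∧ x = y := by
      intro t ht t' ht' x y h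
      have h1 : t = t' := by
        refine hTi t ht t' ht' ?_
        have h2 : t - t' = ((t + π ^ (n + 1) * s x) - (t' + π ^ (n + 1) * s y)) -
          π ^ (n + 1) * (s x - s y) := by ring
        rw [h2]
        exact dvd_sub ((pow_dvd_pow π (n + 1).le_succ).trans h) (dvd_mul_right _ _)
      subst h1
      refine ⟨rfl, ?_⟩
      rw [add_sub_add_left_eq_sub, ← mul_sub, pow_succ π (n + 1)] at h
      have := hres _ _ ((mul_dvd_mul_iff_left (pow_ne_zero _ hπ.ne_zero)).1 h)
      rwa [hs, hs] at this
    -- Each representative is refined by one further π-adic digit, in `q` ways.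
    refine ⟨(T ×ˢ (Finset.univ : Finset k)).image fun z => z.1 + π ^ (n + 1) * s z.2, ?_, ?_, ?_⟩
    · rw [Finset.card_image_of_injOn, Finset.card_product, Finset.card_univ, hcard, hT, pow_succ,
        mul_assoc]
      rintro ⟨t, x⟩ h ⟨t', y⟩ h' heq
      simp only [Finset.coe_product, Set.mem_prod, Finset.mem_coe] at h h'
      obtain ⟨h1, h2⟩ := hinj t h.1 t' h'.1 x y (by
        simp only at heq
        rw [heq, sub_self]
        exact dvd_zero _)
      rw [h1, h2]
    · intro a ha
      obtain ⟨⟨t, x⟩, h, rfl⟩ := Finset.mem_image.1 ha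
      have ht := hTu t (Finset.mem_product.1 h).1
      rw [← IsLocalRing.residue_ne_zero_iff_isUnit] at ht ⊢
      rwa [hres _ t]
      exact Dvd.intro (π ^ n * s x) (by ring)
    · intro a ha b hb h
      obtain ⟨⟨t, x⟩, hx, rfl⟩ := Finset.mem_image.1 ha
      obtain ⟨⟨t', y⟩, hy, rfl⟩ := Finset.mem_image.1 hb
      obtain ⟨h1, h2⟩ := hinj t (Finset.mem_product.1 hx).1 t' (Finset.mem_product.1 hy).1 x y h
      rw [h1, h2]

end Integers

/-! ### Order of vanishing of the reduction -/

section Order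

variable {k : Type*} [Field k]

/-- The power series `f` over a field has a zero of order `d` at the origin. -/
def HasZeroOfOrder (f : k⟦X⟧) (d : ℕ) : Prop :=
  ∃ v : k⟦X⟧, PowerSeries.constantCoeff v ≠ 0 ∧ f = PowerSeries.X ^ d * v

theorem HasZeroOfOrder.order_eq {f : k⟦X⟧} {d : ℕ} (h : HasZeroOfOrder f d) :
    f.order = d := by
  obtain ⟨v, hv, rfl⟩ := h
  rw [PowerSeries.order_mul, PowerSeries.order_X_pow, PowerSeries.order_zero_of_unit, add_zero]
  exact PowerSeries.isUnit_iff_constantCoeff.2 hv.isUnit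

theorem HasZeroOfOrder.ne_zero {f : k⟦X⟧} {d : ℕ} (h : HasZeroOfOrder f d) : f ≠ 0 := by
  rintro rfl
  simpa using h.order_eq

theorem HasZeroOfOrder.comp {f g : k⟦X⟧} {a b : ℕ} (hf : HasZeroOfOrder f a)
    (hg : HasZeroOfOrder g b) (hg0 : PowerSeries.constantCoeff g = 0) :
    HasZeroOfOrder (comp f g) (a * b) := by
  obtain ⟨v, hv, rfl⟩ := hf
  obtain ⟨w, hw, rfl⟩ := hg
  refine ⟨w ^ a * LubinDynamics.comp v (PowerSeries.X ^ b * w), ?_, ?_⟩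
  · rw [map_mul, map_pow, constantCoeff_comp _ hg0]
    exact mul_ne_zero (pow_ne_zero _ hw) hv
  · rw [comp_mul _ _ hg0, comp_pow _ hg0, X_comp hg0, mul_pow, ← pow_mul, mul_comm b a, mul_assoc]

end Order

theorem HasWeierstrassDegree.hasZeroOfOrder {R : Type*} [CommRing R] [IsLocalRing R] {f : R⟦X⟧}
    {d : ℕ} (h : HasWeierstrassDegree f d) :
    HasZeroOfOrder (PowerSeries.map (IsLocalRing.residue R) f) d := by
  have hlt : ∀ i < d, PowerSeries.coeff i (PowerSeries.map (IsLocalRing.residue R) f) = 0 :=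
    fun i hi => by
      rw [PowerSeries.coeff_map]
      by_contra hne
      exact (h.2 ((IsLocalRing.residue_ne_zero_iff_isUnit _).1 hne)).not_gt hi
  obtain ⟨v, hv⟩ := PowerSeries.X_pow_dvd_iff.2 hlt
  refine ⟨v, ?_, hv⟩
  have := congrArg (PowerSeries.coeff d) hv
  rw [PowerSeries.coeff_map, PowerSeries.coeff_X_pow_mul', if_pos le_rfl, Nat.sub_self,
    PowerSeries.coeff_zero_eq_constantCoeff_apply] at this
  rw [← this]
  exact (IsLocalRing.residue_ne_zero_iff_isUnit _).2 h.1

/-! ### The successive quotients of the iterates -/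

section LevelSeries

variable {R : Type*} [CommRing R]

/-- The series `f(T) / T`. -/
def shift (f : R⟦X⟧) : R⟦X⟧ := PowerSeries.mk fun i => PowerSeries.coeff (i + 1) f

theorem X_mul_shift {f : R⟦X⟧} (hf : PowerSeries.constantCoeff f = 0) :
    PowerSeries.X * shift f = f := by
  conv_rhs => rw [f.eq_X_mul_shift_add_const, hf]
  simp [shift]

theorem constantCoeff_shift (f : R⟦X⟧) :
    PowerSeries.constantCoeff (shift f) = PowerSeries.coeff 1 f := by
  rw [← PowerSeries.coeff_zero_eq_constantCoeff_apply, shift, PowerSeries.coeff_mk]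

/-- The quotient of `f^{∘(n+1)}` by `f^{∘n}`. -/
def levelSeries (f : R⟦X⟧) (n : ℕ) : R⟦X⟧ := comp (shift f) (iter f n)

theorem iter_succ_eq_mul {f : R⟦X⟧} (hf : PowerSeries.constantCoeff f = 0) (n : ℕ) :
    iter f (n + 1) = iter f n * levelSeries f n := by
  have h := constantCoeff_iter hf n
  rw [iter, levelSeries]
  conv_lhs => rw [← X_mul_shift hf, comp_mul _ _ (by rwa [X_mul_shift hf]), X_mul_shift hf,
    X_comp h]

theorem constantCoeff_levelSeries {f : R⟦X⟧} (hf : PowerSeries.constantCoeff f = 0) (n : ℕ) :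
    PowerSeries.constantCoeff (levelSeries f n) = PowerSeries.coeff 1 f := by
  rw [levelSeries, constantCoeff_comp _ (constantCoeff_iter hf n), constantCoeff_shift]

theorem coeff_one_iter {f : R⟦X⟧} (hf : PowerSeries.constantCoeff f = 0) (n : ℕ) :
    PowerSeries.coeff 1 (iter f n) = PowerSeries.coeff 1 f ^ n := by
  induction n with
  | zero => simp [iter]
  | succ n ih => rw [iter, coeff_one_comp hf (constantCoeff_iter hf n), ih, pow_succ']

theorem comp_iter_comm {f g : R⟦X⟧} (hf : PowerSeries.constantCoeff f = 0)
    (hg : PowerSeries.constantCoeff g = 0) (h : comp f g = comp g f) (n : ℕ) :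
    comp (iter f n) g = comp g (iter f n) := by
  induction n with
  | zero => rw [iter, X_comp hg, comp_X]
  | succ n ih =>
    have hn := constantCoeff_iter hf n
    rw [iter, comp_assoc _ hn hg, ih, ← comp_assoc _ hg hn, h, comp_assoc _ hf hn]

variable [IsLocalRing R]

theorem hasZeroOfOrder_iter {f : R⟦X⟧} (hf : PowerSeries.constantCoeff f = 0) {q : ℕ}
    (h : HasZeroOfOrder (PowerSeries.map (IsLocalRing.residue R) f) q) (n : ℕ) :
    HasZeroOfOrder (PowerSeries.map (IsLocalRing.residue R) (iter f n)) (q ^ n) := by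
  induction n with
  | zero => exact ⟨1, by simp, by simp [iter]⟩
  | succ n ih =>
    rw [iter, map_comp _ _ (constantCoeff_iter hf n), pow_succ']
    exact h.comp ih (by
      rw [← PowerSeries.coeff_zero_eq_constantCoeff_apply, PowerSeries.coeff_map,
        PowerSeries.coeff_zero_eq_constantCoeff_apply, constantCoeff_iter hf n, map_zero])

/-- Orders multiply under composition: the reduction of f(T)/T has order `q - 1`, that of the
iterate `q ^ n`. -/
theorem hasZeroOfOrder_levelSeries {f : R⟦X⟧} (hf : PowerSeries.constantCoeff f = 0) {q : ℕ}
    (hq : q ≠ 0) (h : HasZeroOfOrder (PowerSeries.map (IsLocalRing.residue R) f) q) (n : ℕ) :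
    HasZeroOfOrder (PowerSeries.map (IsLocalRing.residue R) (levelSeries f n))
      ((q - 1) * q ^ n) := by
  rw [levelSeries, map_comp _ _ (constantCoeff_iter hf n)]
  refine HasZeroOfOrder.comp ?_ (hasZeroOfOrder_iter hf h n) (by
      rw [← PowerSeries.coeff_zero_eq_constantCoeff_apply, PowerSeries.coeff_map,
        PowerSeries.coeff_zero_eq_constantCoeff_apply, constantCoeff_iter hf n, map_zero])
  obtain ⟨v, hv, hv'⟩ := h
  refine ⟨v, hv, ?_⟩
  obtain ⟨m, rfl⟩ := Nat.exists_eq_succ_of_ne_zero hq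
  rw [← X_mul_shift hf, map_mul, PowerSeries.map_X, pow_succ', mul_assoc] at hv'
  exact mul_left_cancel₀ PowerSeries.X_ne_zero hv'

end LevelSeries

theorem evalAt_zero_eq (f : (ringOfIntegers p K)⟦X⟧) :
    evalAt f 0 = integerEmbedding K (PowerSeries.constantCoeff f) := by
  have h0 : ‖(0 : ℂ_[p])‖ < 1 := by simp
  conv_lhs => rw [f.eq_X_mul_shift_add_const]
  rw [evalAt_add _ _ h0, evalAt_mul _ _ h0, evalAt_X, zero_mul, zero_add, ← Polynomial.coe_C,
    evalAt_coe, Polynomial.eval₂_C]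

variable {π : ringOfIntegers p K} {f : (ringOfIntegers p K)⟦X⟧}

/-- The two factors of f^{∘(n+1)} have no common zero: where f^{∘n} vanishes, the level series takes
the value π ≠ 0. -/
theorem mem_torsionLevel_succ_iff (hπ : Irreducible π) (hf : PowerSeries.constantCoeff f = 0)
    (hf₁ : PowerSeries.coeff 1 f = π) (n : ℕ) (u : ℂ_[p]) :
    u ∈ torsionLevel f (n + 1) ↔ ‖u‖ < 1 ∧ evalAt (levelSeries f n) u = 0 := by
  simp only [torsionLevel, Set.mem_ofPred_eq, Nat.add_sub_cancel]
  refine and_congr_right fun hu => ?_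
  rw [iter_succ_eq_mul hf, evalAt_mul _ _ hu]
  refine ⟨fun h => (mul_eq_zero.1 h.1).resolve_left h.2,
    fun h => ⟨by rw [h, mul_zero], fun h0 => ?_⟩⟩
  rw [levelSeries, evalAt_comp _ (constantCoeff_iter hf n) hu, h0, evalAt_zero_eq,
    constantCoeff_shift, hf₁, map_eq_zero_iff _ integerEmbedding_injective] at h
  exact hπ.ne_zero h

/-! ### Weierstrass preparation and Eisenstein polynomials -/

section Eisenstein

open Polynomial in
-- If |u| ≥ 1, then |πR(u)| < |u|^d, which is absurd. Once |u| < 1, the unit constant term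
-- dominates, so |R(u)| = 1.
theorem norm_root_of_eisenstein (hπ : Irreducible π) {d : ℕ}
    {R : (ringOfIntegers p K)[X]} (hR : R.natDegree ≤ d) (hR0 : IsUnit (R.coeff 0)) {u : ℂ_[p]}
    (hu : (X ^ d + C π * R).eval₂ (integerEmbedding K) u = 0) :
    ‖u‖ < 1 ∧ ‖u‖ ^ d = ‖integerEmbedding K π‖ := by
  rw [eval₂_add, eval₂_mul, eval₂_C, eval₂_X_pow] at hu
  have hnorm : ‖u‖ ^ d = ‖integerEmbedding K π‖ * ‖R.eval₂ (integerEmbedding K) u‖ := by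
    rw [← norm_pow, eq_neg_of_add_eq_zero_left hu, norm_neg, norm_mul]
  have hlt : ‖u‖ < 1 := by
    by_contra! h1
    have hle : ‖R.eval₂ (integerEmbedding K) u‖ ≤ ‖u‖ ^ d := by
      rw [eval₂_eq_sum_range]
      refine IsUltrametricDist.norm_sum_le_of_forall_le_of_nonneg (by positivity) fun i hi => ?_
      rw [norm_mul, norm_pow]
      refine (mul_le_of_le_one_left (by positivity) (norm_integerEmbedding_le_one _)).trans ?_
      exact pow_le_pow_right₀ h1 ((Nat.lt_succ_iff.1 (Finset.mem_range.1 hi)).trans hR)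
    have hpos : 0 < ‖u‖ ^ d := by positivity
    have := mul_le_mul_of_nonneg_left hle (norm_nonneg (integerEmbedding K π))
    rw [← hnorm] at this
    nlinarith [norm_uniformizer_lt_one hπ]
  refine ⟨hlt, ?_⟩
  rw [hnorm]
  have hsplit := R.divX_mul_X_add
  have h1 : ‖R.divX.eval₂ (integerEmbedding K) u * u‖ < ‖integerEmbedding K (R.coeff 0)‖ := by
    rw [(isUnit_iff_norm_eq_one _).1 hR0, norm_mul, ← evalAt_coe]
    exact (mul_le_of_le_one_left (norm_nonneg _) (norm_evalAt_le_one _ hlt)).trans_lt hlt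
  rw [← hsplit, eval₂_add, eval₂_mul, eval₂_X, eval₂_C,
    IsUltrametricDist.norm_add_eq_max_of_norm_ne_norm h1.ne, max_eq_right h1.le,
    (isUnit_iff_norm_eq_one _).1 hR0, mul_one]

variable [FiniteDimensional ℚ_[p] K]

open Polynomial in
-- Weierstrass preparation gives h = PU with P distinguished of degree `d`. Since U(0) is a unit and
-- h(0) = π, P is Eisenstein, hence irreducible over `K` by Gauss's lemma. The unit U has no zeros
-- in the disc, and all roots of P lie there.
theorem exists_irreducible_of_levelSeries (hπ : Irreducible π) {h : (ringOfIntegers p K)⟦X⟧} {d : ℕ}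
    (hd : d ≠ 0) (h0 : PowerSeries.constantCoeff h = π)
    (hord : HasZeroOfOrder (PowerSeries.map (IsLocalRing.residue (ringOfIntegers p K)) h) d) :
    ∃ P : K[X], P.Monic ∧ Irreducible P ∧ P.natDegree = d ∧
      ∀ u : ℂ_[p], (‖u‖ < 1 ∧ evalAt h u = 0 ↔ aeval u P = 0) ∧
        (aeval u P = 0 → ‖u‖ ^ d = ‖integerEmbedding K π‖) := by
  have := isAdicComplete_ringOfIntegers hπ
  obtain ⟨P, U, H⟩ := PowerSeries.exists_isWeierstrassFactorization hord.ne_zero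
  have hPd : P.natDegree = d := by
    rw [H.natDegree_eq_toNat_order_map, hord.order_eq, ENat.toNat_natCast]
  have hPm : P.Monic := H.isDistinguishedAt.monic
  have hdvd : C π ∣ P - X ^ d := by
    rw [C_dvd_iff_dvd_coeff]
    intro i
    rw [coeff_sub, coeff_X_pow]
    rcases lt_trichotomy i d with hi | rfl | hi
    · rw [if_neg hi.ne, sub_zero, ← Ideal.mem_span_singleton, ← maximalIdeal_eq_span hπ]
      exact H.isDistinguishedAt.mem (hi.trans_eq hPd.symm)
    · rw [if_pos rfl]
      have := hPm.coeff_natDegree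
      rw [hPd] at this
      rw [this, sub_self]
      exact dvd_zero _
    · rw [if_neg hi.ne', coeff_eq_zero_of_natDegree_lt (by omega), sub_zero]
      exact dvd_zero _
  obtain ⟨R, hR⟩ := hdvd
  have hPR : P = X ^ d + C π * R := by rw [← hR]; ring
  have hRd : R.natDegree ≤ d := by
    rw [← natDegree_C_mul hπ.ne_zero, ← hR]
    exact (natDegree_sub_le _ _).trans (max_le hPd.le (natDegree_X_pow_le d))
  have hP0 : P.coeff 0 = π * R.coeff 0 := by
    rw [hPR, coeff_add, coeff_X_pow, if_neg (Ne.symm hd), coeff_C_mul, zero_add]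
  have hR0 : IsUnit (R.coeff 0) := by
    have := congrArg PowerSeries.constantCoeff H.eq_mul
    rw [h0, map_mul, Polynomial.constantCoeff_coe, hP0, mul_assoc] at this
    exact IsUnit.of_mul_eq_one _ (mul_left_cancel₀ hπ.ne_zero (by rw [← this, mul_one]))
  have hEis : P.IsEisensteinAt (IsLocalRing.maximalIdeal (ringOfIntegers p K)) := by
    refine hPm.isEisensteinAt_of_mem_of_notMem (IsLocalRing.maximalIdeal.isMaximal _).ne_top
      (fun {n} hn => H.isDistinguishedAt.mem hn) ?_
    rw [mem_maximalIdeal_pow_iff_dvd hπ, hP0, sq, mul_dvd_mul_iff_left hπ.ne_zero]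
    exact fun hu => hπ.not_isUnit (isUnit_of_dvd_unit hu hR0)
  have hPirr : Irreducible P := hEis.irreducible
    (IsLocalRing.maximalIdeal.isMaximal _).isPrime hPm.isPrimitive (by omega)
  have heval : ∀ u : ℂ_[p], aeval u (P.map (algebraMap (ringOfIntegers p K) K)) =
      P.eval₂ (integerEmbedding K) u := fun u => by
    rw [aeval_def, eval₂_map]
    rfl
  refine ⟨P.map (algebraMap (ringOfIntegers p K) K), hPm.map _,
    (hPm.irreducible_iff_irreducible_map_fraction_map).1 hPirr,
    by rw [hPm.natDegree_map, hPd], fun u => ?_⟩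
  rw [heval]
  have hroot := fun hu : P.eval₂ (integerEmbedding K) u = 0 =>
    norm_root_of_eisenstein hπ hRd hR0 (u := u) (by rwa [← hPR])
  refine ⟨⟨fun ⟨hu, h⟩ => ?_, fun hu => ⟨(hroot hu).1, ?_⟩⟩, fun hu => (hroot hu).2⟩
  · rw [H.eq_mul, evalAt_mul _ _ hu, evalAt_coe] at h
    exact (mul_eq_zero.1 h).resolve_right (evalAt_ne_zero_of_isUnit H.isUnit hu)
  · rw [H.eq_mul, evalAt_mul _ _ (hroot hu).1, evalAt_coe, hu, zero_mul]

open Polynomial in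
-- The remainder of the Weierstrass division of `g` by `h` has degree less than `d` and vanishes at
-- `u`, whose degree over `K` is at least `d`.
theorem dvd_of_evalAt_eq_zero (hπ : Irreducible π) {g h : (ringOfIntegers p K)⟦X⟧} {d : ℕ}
    (hord : HasZeroOfOrder (PowerSeries.map (IsLocalRing.residue (ringOfIntegers p K)) h) d)
    {u : ℂ_[p]} (hu : ‖u‖ < 1) (hdeg : d ≤ (minpoly K u).natDegree) (hh : evalAt h u = 0)
    (hg : evalAt g u = 0) : h ∣ g := by
  have := isAdicComplete_ringOfIntegers hπ
  obtain ⟨q, r, H⟩ := PowerSeries.exists_isWeierstrassDivision (f := g) hord.ne_zero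
  have hdr : r.degree < d := by
    have := H.degree_lt
    change r.degree <
      ((PowerSeries.map (IsLocalRing.residue (ringOfIntegers p K)) h).order.toNat : WithBot ℕ) at this
    rwa [hord.order_eq, ENat.toNat_natCast] at this
  have hr : r.eval₂ (integerEmbedding K) u = 0 := by
    rw [H.eq_mul_add, evalAt_add _ _ hu, evalAt_mul _ _ hu, hh, zero_mul, zero_add,
      evalAt_coe] at hg
    exact hg
  have hr0 : r.map (algebraMap (ringOfIntegers p K) K) = 0 := by
    by_contra hne
    have h1 := natDegree_le_natDegree <| minpoly.degree_le_of_ne_zero K u hne (by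
      rw [aeval_def, eval₂_map]
      exact hr)
    rw [natDegree_map_eq_of_injective Subtype.val_injective] at h1
    have hr0 : r ≠ 0 := by rintro rfl; simp at hne
    rw [degree_eq_natDegree hr0] at hdr
    have := Nat.cast_lt.1 hdr
    omega
  rw [Polynomial.map_eq_zero_iff Subtype.val_injective] at hr0
  exact ⟨q, by rw [H.eq_mul_add, hr0, Polynomial.coe_zero, add_zero]⟩

end Eisenstein

/-! ### The action of the units on the levels -/

/-- The cardinality of the residue field of `K`. -/
def residueCard (K : IntermediateField ℚ_[p] ℂ_[p]) : ℕ :=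
  Nat.card (IsLocalRing.ResidueField (ringOfIntegers p K))

/-- The degree of the field generated by a point of level `n + 1`. -/
def levelDegree (K : IntermediateField ℚ_[p] ℂ_[p]) (n : ℕ) : ℕ :=
  (residueCard K - 1) * residueCard K ^ n

variable {π : ringOfIntegers p K} {F : ringOfIntegers p K → (ringOfIntegers p K)⟦X⟧}

instance isTorsionFree_padicComplex (L : IntermediateField ℚ_[p] ℂ_[p]) :
    Module.IsTorsionFree L ℂ_[p] :=
  Module.IsTorsionFree.of_smul_eq_zero fun a x h => by
    have h' : (a : ℂ_[p]) * x = 0 := h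
    exact (mul_eq_zero.1 h').imp (fun h => Subtype.ext h) id

section Levels

namespace IsFullCommutingFamily

/-- `Nat.card` is 0 for an infinite type, so this is the finiteness of the residue field. It comes
from the Weierstrass degree, as the constant coefficient is not a unit. -/
theorem residueCard_ne_zero (hF : IsFullCommutingFamily π F) : residueCard K ≠ 0 := by
  intro h
  have h1 := hF.wideg.1
  change IsUnit (PowerSeries.coeff (residueCard K) (F π)) at h1
  rw [h, PowerSeries.coeff_zero_eq_constantCoeff_apply, hF.constantCoeff_eq_zero] at h1
  exact not_isUnit_zero h1

theorem levelDegree_ne_zero (hF : IsFullCommutingFamily π F) (n : ℕ) : levelDegree K n ≠ 0 := by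
  have : Finite (IsLocalRing.ResidueField (ringOfIntegers p K)) :=
    Nat.finite_of_card_ne_zero hF.residueCard_ne_zero
  have h1 : 1 < residueCard K := Finite.one_lt_card
  exact mul_ne_zero (by omega) (pow_ne_zero _ (by omega))

theorem hasZeroOfOrder_levelSeries (hF : IsFullCommutingFamily π F) (n : ℕ) :
    HasZeroOfOrder (PowerSeries.map (IsLocalRing.residue _) (levelSeries (F π) n))
      (levelDegree K n) :=
  LubinDynamics.hasZeroOfOrder_levelSeries (hF.constantCoeff_eq_zero π) hF.residueCard_ne_zero
    hF.wideg.hasZeroOfOrder n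

theorem evalAt_comm (hF : IsFullCommutingFamily π F) (α β : ringOfIntegers p K) {u : ℂ_[p]}
    (hu : ‖u‖ < 1) : evalAt (F α) (evalAt (F β) u) = evalAt (F β) (evalAt (F α) u) := by
  rw [← evalAt_comp _ (hF.constantCoeff_eq_zero β) hu, hF.commute,
    evalAt_comp _ (hF.constantCoeff_eq_zero α) hu]

theorem evalAt_iter_comm (hF : IsFullCommutingFamily π F) (α : ringOfIntegers p K) (n : ℕ)
    {u : ℂ_[p]} (hu : ‖u‖ < 1) : evalAt (iter (F π) n) (evalAt (F α) u) =
      evalAt (F α) (evalAt (iter (F π) n) u) := by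
  have hπ0 := hF.constantCoeff_eq_zero π
  have hα0 := hF.constantCoeff_eq_zero α
  rw [← evalAt_comp _ hα0 hu, comp_iter_comm hπ0 hα0 (hF.commute π α),
    evalAt_comp _ (constantCoeff_iter hπ0 n) hu]

/-- Both sides commute with F_π and have linear coefficient αβ, so rigidity applies. -/
theorem comp_eq (hF : IsFullCommutingFamily π F) (hπ : Irreducible π) (α β : ringOfIntegers p K) :
    comp (F α) (F β) = F (α * β) := by
  have h0 := hF.constantCoeff_eq_zero
  refine eq_of_comp_comm (f := F π) (h0 π) (fun m hm h => ?_) ?_ (h0 _) ?_ ?_ (hF.commute _ _)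
  · rw [hF.coeff_one, ← Nat.sub_add_cancel (show 1 ≤ m by omega), pow_succ,
      mul_eq_right₀ hπ.ne_zero] at h
    exact hπ.not_isUnit (IsUnit.of_pow_eq_one h (by omega))
  · rw [constantCoeff_comp _ (h0 β), h0]
  · rw [coeff_one_comp (h0 α) (h0 β), hF.coeff_one, hF.coeff_one, hF.coeff_one]
  · rw [← comp_assoc _ (h0 α) (h0 β), hF.commute π α, comp_assoc _ (h0 π) (h0 β),
      hF.commute π β, ← comp_assoc _ (h0 β) (h0 π)]

theorem evalAt_mul_eq (hF : IsFullCommutingFamily π F) (hπ : Irreducible π)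
    (α β : ringOfIntegers p K) {u : ℂ_[p]} (hu : ‖u‖ < 1) :
    evalAt (F (α * β)) u = evalAt (F α) (evalAt (F β) u) := by
  rw [← hF.comp_eq hπ, evalAt_comp _ (hF.constantCoeff_eq_zero β) hu]

theorem evalAt_eq_zero_iff (hF : IsFullCommutingFamily π F) {α : ringOfIntegers p K}
    (hα : IsUnit α) {u : ℂ_[p]} (hu : ‖u‖ < 1) : evalAt (F α) u = 0 ↔ u = 0 := by
  have h0 := hF.constantCoeff_eq_zero α
  refine ⟨fun h => ?_, fun h => by rw [h, evalAt_zero_right h0]⟩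
  rw [← X_mul_shift h0, evalAt_mul _ _ hu, evalAt_X] at h
  refine (mul_eq_zero.1 h).resolve_right (evalAt_ne_zero_of_isUnit ?_ hu)
  rwa [PowerSeries.isUnit_iff_constantCoeff, constantCoeff_shift, hF.coeff_one]

theorem evalAt_mem_torsionLevel (hF : IsFullCommutingFamily π F) {α : ringOfIntegers p K}
    (hα : IsUnit α) {n : ℕ} {u : ℂ_[p]} (hu : u ∈ torsionLevel (F π) n) :
    evalAt (F α) u ∈ torsionLevel (F π) n := by
  obtain ⟨h1, h2, h3⟩ := hu
  have hlt (m : ℕ) : ‖evalAt (iter (F π) m) u‖ < 1 :=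
    norm_evalAt_lt_one _ (constantCoeff_iter (hF.constantCoeff_eq_zero π) m) h1
  refine ⟨norm_evalAt_lt_one _ (hF.constantCoeff_eq_zero α) h1, ?_, ?_⟩
  · rw [hF.evalAt_iter_comm α _ h1, hF.evalAt_eq_zero_iff hα (hlt _), h2]
  · rwa [hF.evalAt_iter_comm α _ h1, Ne, hF.evalAt_eq_zero_iff hα (hlt _)]

theorem evalAt_iter_mem_torsionLevel (hF : IsFullCommutingFamily π F) {n k : ℕ} {u : ℂ_[p]}
    (hu : u ∈ torsionLevel (F π) (n + k + 1)) :
    evalAt (iter (F π) k) u ∈ torsionLevel (F π) (n + 1) := by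
  obtain ⟨h1, h2, h3⟩ := hu
  have h0 := hF.constantCoeff_eq_zero π
  refine ⟨norm_evalAt_lt_one _ (constantCoeff_iter h0 k) h1, ?_, ?_⟩
  · rw [← evalAt_iter_add h0 _ _ h1, ← h2]
    congr 2
    omega
  · rw [← evalAt_iter_add h0 _ _ h1]
    exact h3

variable [FiniteDimensional ℚ_[p] K]

theorem exists_polynomial (hF : IsFullCommutingFamily π F) (hπ : Irreducible π) (n : ℕ) :
    ∃ P : Polynomial K, P.Monic ∧ Irreducible P ∧ P.natDegree = levelDegree K n ∧
      ∀ u : ℂ_[p], (u ∈ torsionLevel (F π) (n + 1) ↔ Polynomial.aeval u P = 0) ∧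
        (Polynomial.aeval u P = 0 → ‖u‖ ^ levelDegree K n = ‖integerEmbedding K π‖) := by
  have h0 := hF.constantCoeff_eq_zero π
  obtain ⟨P, h1, h2, h3, h4⟩ := exists_irreducible_of_levelSeries hπ (hF.levelDegree_ne_zero n)
    ((constantCoeff_levelSeries h0 n).trans (hF.coeff_one π)) (hF.hasZeroOfOrder_levelSeries n)
  refine ⟨P, h1, h2, h3, fun u => ⟨?_, (h4 u).2⟩⟩
  rw [mem_torsionLevel_succ_iff hπ h0 (hF.coeff_one π), (h4 u).1]

/-- The monic irreducible polynomial over `K` whose roots are the points of level `n + 1`. -/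
def levelPolynomial (hF : IsFullCommutingFamily π F) (hπ : Irreducible π) (n : ℕ) :
    Polynomial K := (hF.exists_polynomial hπ n).choose

variable (hF : IsFullCommutingFamily π F) (hπ : Irreducible π)

theorem levelPolynomial_monic (n : ℕ) : (hF.levelPolynomial hπ n).Monic :=
  (hF.exists_polynomial hπ n).choose_spec.1

theorem levelPolynomial_irreducible (n : ℕ) : Irreducible (hF.levelPolynomial hπ n) :=
  (hF.exists_polynomial hπ n).choose_spec.2.1

theorem natDegree_levelPolynomial (n : ℕ) :
    (hF.levelPolynomial hπ n).natDegree = levelDegree K n :=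
  (hF.exists_polynomial hπ n).choose_spec.2.2.1

theorem mem_torsionLevel_iff_aeval (n : ℕ) (u : ℂ_[p]) :
    u ∈ torsionLevel (F π) (n + 1) ↔ Polynomial.aeval u (hF.levelPolynomial hπ n) = 0 :=
  ((hF.exists_polynomial hπ n).choose_spec.2.2.2 u).1

theorem mem_torsionLevel_iff_mem_rootSet (n : ℕ) (u : ℂ_[p]) :
    u ∈ torsionLevel (F π) (n + 1) ↔ u ∈ (hF.levelPolynomial hπ n).rootSet ℂ_[p] := by
  rw [Polynomial.mem_rootSet_of_ne (hF.levelPolynomial_irreducible hπ n).ne_zero,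
    hF.mem_torsionLevel_iff_aeval hπ]

include hF hπ

theorem norm_pow_of_mem_torsionLevel {n : ℕ} {u : ℂ_[p]} (hu : u ∈ torsionLevel (F π) (n + 1)) :
    ‖u‖ ^ levelDegree K n = ‖integerEmbedding K π‖ :=
  ((hF.exists_polynomial hπ n).choose_spec.2.2.2 u).2 ((hF.mem_torsionLevel_iff_aeval hπ n u).1 hu)

theorem minpoly_eq_levelPolynomial {n : ℕ} {u : ℂ_[p]} (hu : u ∈ torsionLevel (F π) (n + 1)) :
    minpoly K u = hF.levelPolynomial hπ n :=
  (minpoly.eq_of_irreducible_of_monic (hF.levelPolynomial_irreducible hπ n)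
    ((hF.mem_torsionLevel_iff_aeval hπ n u).1 hu) (hF.levelPolynomial_monic hπ n)).symm

theorem natDegree_minpoly {n : ℕ} {u : ℂ_[p]} (hu : u ∈ torsionLevel (F π) (n + 1)) :
    (minpoly K u).natDegree = levelDegree K n := by
  rw [hF.minpoly_eq_levelPolynomial hπ hu, natDegree_levelPolynomial]

theorem isIntegral_of_mem_torsionLevel {n : ℕ} {u : ℂ_[p]}
    (hu : u ∈ torsionLevel (F π) (n + 1)) : IsIntegral K u :=
  ⟨_, hF.levelPolynomial_monic hπ n, (hF.mem_torsionLevel_iff_aeval hπ n u).1 hu⟩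

theorem torsionLevel_nonempty (n : ℕ) : (torsionLevel (F π) (n + 1)).Nonempty := by
  obtain ⟨u, hu⟩ := IsAlgClosed.exists_aeval_eq_zero ℂ_[p] (hF.levelPolynomial hπ n)
    (Polynomial.degree_pos_of_irreducible (hF.levelPolynomial_irreducible hπ n)).ne'
  exact ⟨u, (hF.mem_torsionLevel_iff_aeval hπ n u).2 hu⟩

/-- F_α and F_β agree at every iterate F_π^{∘k}(u) as well, by commutation. Using one iterate in
each level, the level series are split off F_α - F_β one after the other. -/
theorem iter_dvd_sub_of_evalAt_eq {α β : ringOfIntegers p K} {n : ℕ} {u : ℂ_[p]}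
    (hu : u ∈ torsionLevel (F π) (n + 1)) (h : evalAt (F α) u = evalAt (F β) u) :
    iter (F π) (n + 1) ∣ F α - F β := by
  have h0 := hF.constantCoeff_eq_zero
  suffices H : ∀ m ≤ n + 1, iter (F π) m ∣ F α - F β from H _ le_rfl
  intro m
  induction m with
  | zero =>
    intro _
    rw [iter, PowerSeries.X_dvd_iff, map_sub, h0, h0, sub_zero]
  | succ m ih =>
    intro hm
    obtain ⟨g, hg⟩ := ih (by omega)
    obtain ⟨k, rfl⟩ := Nat.exists_eq_add_of_le (Nat.succ_le_succ_iff.1 hm)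
    set w := evalAt (iter (F π) k) u
    have hw : w ∈ torsionLevel (F π) (m + 1) := hF.evalAt_iter_mem_torsionLevel hu
    have hαβ : evalAt (F α) w = evalAt (F β) w := by
      rw [← hF.evalAt_iter_comm α k hu.1, ← hF.evalAt_iter_comm β k hu.1, h]
    -- The point `w` has exact level `m + 1`, so the part already split off does not vanish there.
    have hgw : evalAt g w = 0 := by
      have := congrArg (evalAt · w) hg
      simp only [evalAt_sub _ _ hw.1, evalAt_mul _ _ hw.1, hαβ, sub_self] at this
      exact (mul_eq_zero.1 this.symm).resolve_left hw.2.2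
    obtain ⟨g', rfl⟩ := dvd_of_evalAt_eq_zero hπ (hF.hasZeroOfOrder_levelSeries m) hw.1
      (hF.natDegree_minpoly hπ hw).ge
      ((mem_torsionLevel_succ_iff hπ (h0 π) (hF.coeff_one π) m w).1 hw).2 hgw
    exact ⟨g', by rw [hg, iter_succ_eq_mul (h0 π), mul_assoc]⟩

/-- The linear coefficient of F_π^{∘(n+1)} is π^{n+1}. -/
theorem pow_dvd_sub_of_evalAt_eq {α β : ringOfIntegers p K} {n : ℕ} {u : ℂ_[p]}
    (hu : u ∈ torsionLevel (F π) (n + 1)) (h : evalAt (F α) u = evalAt (F β) u) :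
    π ^ (n + 1) ∣ α - β := by
  obtain ⟨g, hg⟩ := hF.iter_dvd_sub_of_evalAt_eq hπ hu h
  have h0 := hF.constantCoeff_eq_zero π
  have h1 := congrArg (PowerSeries.coeff 1) hg
  rw [map_sub, hF.coeff_one, hF.coeff_one, ← X_mul_shift (constantCoeff_iter h0 (n + 1)),
    mul_assoc, coeff_one_X_mul, map_mul, constantCoeff_shift, coeff_one_iter h0, hF.coeff_one] at h1
  exact ⟨_, h1⟩

/-- Transitivity by counting: a ↦ F_a(u) is injective on (q-1)q^n incongruent units and lands in the
roots of a polynomial of that degree. -/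
theorem exists_representatives {n : ℕ} {u : ℂ_[p]} (hu : u ∈ torsionLevel (F π) (n + 1)) :
    ∃ T : Finset (ringOfIntegers p K), (∀ a ∈ T, IsUnit a) ∧
      (∀ a ∈ T, ∀ b ∈ T, π ^ (n + 1) ∣ a - b → a = b) ∧
      ∀ v ∈ torsionLevel (F π) (n + 1), ∃ a ∈ T, evalAt (F a) u = v := by
  classical
  obtain ⟨T, hT, hTu, hTi⟩ := exists_units_pairwise_incongruent hπ hF.residueCard_ne_zero rfl n
  refine ⟨T, hTu, hTi, fun v hv => ?_⟩
  set P := hF.levelPolynomial hπ n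
  have hsub : T.image (fun a => evalAt (F a) u) ⊆ (P.aroots ℂ_[p]).toFinset := fun v hv => by
    obtain ⟨a, ha, rfl⟩ := Finset.mem_image.1 hv
    exact Finset.mem_coe.1 ((hF.mem_torsionLevel_iff_mem_rootSet hπ n _).1
      (hF.evalAt_mem_torsionLevel (hTu a ha) hu))
  have hcard : (P.aroots ℂ_[p]).toFinset.card ≤ (T.image fun a => evalAt (F a) u).card := by
    rw [Finset.card_image_of_injOn fun a ha b hb h =>
      hTi a ha b hb (hF.pow_dvd_sub_of_evalAt_eq hπ hu h), hT]
    refine (Multiset.toFinset_card_le _).trans ((Polynomial.card_roots' _).trans ?_)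
    rw [Polynomial.natDegree_map]
    exact (hF.natDegree_levelPolynomial hπ n).le
  have := Finset.eq_of_subset_of_card_le hsub hcard
  have hv' : v ∈ (P.aroots ℂ_[p]).toFinset :=
    Finset.mem_coe.1 ((hF.mem_torsionLevel_iff_mem_rootSet hπ n _).1 hv)
  rw [← this] at hv'
  exact Finset.mem_image.1 hv'

theorem exists_unit_evalAt_eq {n : ℕ} {u v : ℂ_[p]} (hu : u ∈ torsionLevel (F π) (n + 1))
    (hv : v ∈ torsionLevel (F π) (n + 1)) :
    ∃ α : (ringOfIntegers p K)ˣ, evalAt (F α) u = v := by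
  obtain ⟨T, hTu, -, hT⟩ := hF.exists_representatives hπ hu
  obtain ⟨a, ha, h⟩ := hT v hv
  exact ⟨(hTu a ha).unit, h⟩

/-- Without an addition law, the converse also rests on the counting: F_α(u) and F_β(u) are attained
at representatives congruent to α and β, and these coincide when α ≡ β. -/
theorem evalAt_eq_iff_pow_dvd_sub {α β : ringOfIntegers p K} (hα : IsUnit α) (hβ : IsUnit β)
    {n : ℕ} {u : ℂ_[p]} (hu : u ∈ torsionLevel (F π) (n + 1)) :
    evalAt (F α) u = evalAt (F β) u ↔ π ^ (n + 1) ∣ α - β := by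
  refine ⟨hF.pow_dvd_sub_of_evalAt_eq hπ hu, fun h => ?_⟩
  obtain ⟨T, hTu, hTi, hT⟩ := hF.exists_representatives hπ hu
  obtain ⟨a, ha, h₁⟩ := hT _ (hF.evalAt_mem_torsionLevel hα hu)
  obtain ⟨b, hb, h₂⟩ := hT _ (hF.evalAt_mem_torsionLevel hβ hu)
  have hab : a = b := by
    refine hTi a ha b hb ?_
    have := dvd_add (dvd_add (hF.pow_dvd_sub_of_evalAt_eq hπ hu h₁) h)
      (hF.pow_dvd_sub_of_evalAt_eq hπ hu h₂.symm)
    rwa [sub_add_sub_cancel, sub_add_sub_cancel] at this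
  rw [← h₁, ← h₂, hab]

end IsFullCommutingFamily

end Levels

/-! ### Galois automorphisms, norms and convergence -/

section Norm

theorem norm_eq_spectralValue_minpoly {x : ℂ_[p]} (hx : IsAlgebraic ℚ_[p] x) :
    ‖x‖ = spectralValue (minpoly ℚ_[p] x) := by
  obtain ⟨y, rfl⟩ : x ∈ (algebraMap (PadicAlgCl p) ℂ_[p]).range :=
    IsIntegral.mem_range_algebraMap_of_minpoly_splits hx.isIntegral
      (IsAlgClosed.splits _)
  rw [minpoly.algebraMap_eq (algebraMap (PadicAlgCl p) ℂ_[p]).injective]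
  exact PadicComplex.norm_extends p y

variable [FiniteDimensional ℚ_[p] K] {L : IntermediateField K ℂ_[p]}

/-- The norm of an algebraic element is the spectral value of its minimal polynomial over `ℚ_[p]`,
which `g` preserves. -/
theorem norm_algEquiv [Algebra.IsAlgebraic K L] (g : Gal(L/K)) (x : L) :
    ‖((g x : L) : ℂ_[p])‖ = ‖(x : ℂ_[p])‖ := by
  have : Algebra.IsAlgebraic ℚ_[p] L := Algebra.IsAlgebraic.trans ℚ_[p] K L
  have : IsScalarTower ℚ_[p] L ℂ_[p] := IsScalarTower.of_algebraMap_eq fun _ => rfl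
  have h (y : L) : ‖(y : ℂ_[p])‖ = spectralValue (minpoly ℚ_[p] y) := by
    have hy : IsAlgebraic ℚ_[p] (algebraMap L ℂ_[p] y) :=
      (Algebra.IsAlgebraic.isAlgebraic y).algebraMap
    rw [← minpoly.algebraMap_eq (algebraMap L ℂ_[p]).injective y]
    exact norm_eq_spectralValue_minpoly hy
  rw [h, h, ← minpoly.algEquiv_eq (g.restrictScalars ℚ_[p]) x]
  rfl

/-- Since `g` is an isometry, it carries the partial sums converging to `v` to partial sums
converging to `g v`. `L` need not be complete, so membership of the sum in `L` is an input. -/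
theorem coe_algEquiv_evalAt [Algebra.IsAlgebraic K L] (g : Gal(L/K))
    (f : (ringOfIntegers p K)⟦X⟧) {u v : L} (hu : ‖(u : ℂ_[p])‖ < 1)
    (hv : (v : ℂ_[p]) = evalAt f u) :
    ((g v : L) : ℂ_[p]) = evalAt f ((g u : L) : ℂ_[p]) := by
  have hgu : ‖((g u : L) : ℂ_[p])‖ < 1 := by rwa [norm_algEquiv]
  set t : ℕ → L := fun n =>
    algebraMap K L ((PowerSeries.coeff n f : ringOfIntegers p K) : K) * u ^ n
  have h1 : HasSum (fun n => (t n : ℂ_[p])) (v : ℂ_[p]) := by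
    rw [hv]
    exact hasSum_evalAt f hu
  have h2 : HasSum (fun n => ((g (t n) : L) : ℂ_[p])) (evalAt f ((g u : L) : ℂ_[p])) := by
    convert hasSum_evalAt f hgu using 2 with n
    rw [map_mul, map_pow, AlgEquiv.commutes]
    rfl
  refine HasSum.unique ?_ h2
  rw [HasSum, tendsto_iff_norm_sub_tendsto_zero] at h1 ⊢
  refine h1.congr fun s => ?_
  have h3 (w : ℕ → L) (z : L) : ∑ n ∈ s, (w n : ℂ_[p]) - z = ((∑ n ∈ s, w n - z : L) : ℂ_[p]) := by
    push_cast
    rfl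
  rw [h3, h3, ← map_sum, ← map_sub, norm_algEquiv]

theorem evalAt_mem_of_finiteDimensional [FiniteDimensional K L] (f : (ringOfIntegers p K)⟦X⟧)
    {u : ℂ_[p]} (hu : ‖u‖ < 1) (huL : u ∈ L) : evalAt f u ∈ L := by
  have : FiniteDimensional ℚ_[p] (L.restrictScalars ℚ_[p]) := FiniteDimensional.trans ℚ_[p] K L
  refine (isClosed_of_finiteDimensional (K := L.restrictScalars ℚ_[p])).mem_of_tendsto
    (hasSum_evalAt f hu) (Filter.Eventually.of_forall fun s => ?_)
  exact L.sum_mem fun n _ => L.mul_mem (L.algebraMap_mem _) (L.pow_mem huL n)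

end Norm

/-! ### Value groups and ramification indices -/

section Ramification

variable {A B : Type*} [Field A] [Field B] [Algebra A ℂ_[p]] [Algebra B ℂ_[p]]

theorem mem_valueGroup {E : Type*} [Field E] [Algebra E ℂ_[p]] (r : ℝˣ) :
    r ∈ valueGroup p E ↔ ∃ x : E, x ≠ 0 ∧ ‖algebraMap E ℂ_[p] x‖ = r := by
  constructor
  · rintro ⟨x, rfl⟩
    exact ⟨x, x.ne_zero, rfl⟩
  · rintro ⟨x, hx, h⟩
    exact ⟨Units.mk0 x hx, Units.ext h⟩

/-- The order of the class of |x| in the quotient of value groups is a multiple of `d` and divides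
the index. -/
theorem dvd_relIndex_valueGroup {d : ℕ} {x : B} (hx : x ≠ 0)
    (h : ∀ (n : ℕ) (y : A), y ≠ 0 → ‖algebraMap B ℂ_[p] x‖ ^ n = ‖algebraMap A ℂ_[p] y‖ → d ∣ n) :
    d ∣ (valueGroup p A).relIndex (valueGroup p B) := by
  set H := (valueGroup p A).subgroupOf (valueGroup p B)
  have hx' : ‖algebraMap B ℂ_[p] x‖ ≠ 0 := norm_ne_zero_iff.2 (by simpa using hx)
  let r : valueGroup p B := ⟨Units.mk0 _ hx', (mem_valueGroup _).2 ⟨x, hx, rfl⟩⟩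
  refine dvd_trans ?_ (orderOf_dvd_natCard (QuotientGroup.mk r : valueGroup p B ⧸ H))
  have h1 := pow_orderOf_eq_one (QuotientGroup.mk r : valueGroup p B ⧸ H)
  rw [← QuotientGroup.mk_pow, QuotientGroup.eq_one_iff, Subgroup.mem_subgroupOf,
    mem_valueGroup] at h1
  obtain ⟨y, hy, h2⟩ := h1
  exact h _ y hy (by rw [h2]; rfl)

variable [Algebra A B] [IsScalarTower A B ℂ_[p]]

theorem valueGroup_mono : valueGroup p A ≤ valueGroup p B := fun r hr => by
  obtain ⟨x, hx, h⟩ := (mem_valueGroup r).1 hr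
  refine (mem_valueGroup r).2 ⟨algebraMap A B x, by simpa using hx, ?_⟩
  rw [← h, ← IsScalarTower.algebraMap_apply]

/-- The nonzero terms of a linear combination have pairwise distinct norms, so the largest cannot be
cancelled. -/
theorem linearIndependent_of_norm_incongruent {ι : Type*} (b : ι → B) (hb : ∀ i, b i ≠ 0)
    (h : ∀ (i j : ι) (x : A), x ≠ 0 →
      ‖algebraMap B ℂ_[p] (b i)‖ = ‖algebraMap A ℂ_[p] x‖ * ‖algebraMap B ℂ_[p] (b j)‖ → i = j) :
    LinearIndependent A b := by
  classical
  rw [linearIndependent_iff']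
  intro s a hsum
  by_contra! hne
  obtain ⟨i₀, hi₀, hai₀⟩ := hne
  set t : ι → ℂ_[p] := fun i => algebraMap B ℂ_[p] (a i • b i)
  have ht (i : ι) : t i = algebraMap A ℂ_[p] (a i) * algebraMap B ℂ_[p] (b i) := by
    simp only [t]
    rw [Algebra.smul_def, map_mul, ← IsScalarTower.algebraMap_apply]
  have hts : ∑ i ∈ s, t i = 0 := by
    rw [← map_sum, hsum, map_zero]
  obtain ⟨i, hi, hmax⟩ := s.exists_max_image (fun i => ‖t i‖) ⟨i₀, hi₀⟩
  have hb' (i : ι) : 0 < ‖algebraMap B ℂ_[p] (b i)‖ := norm_pos_iff.2 (by simpa using hb i)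
  have hti : 0 < ‖t i‖ := by
    refine lt_of_lt_of_le ?_ (hmax i₀ hi₀)
    rw [ht, norm_mul]
    exact mul_pos (norm_pos_iff.2 (by simpa using hai₀)) (hb' i₀)
  have hai : a i ≠ 0 := by
    intro h0
    rw [ht, h0, map_zero, zero_mul, norm_zero] at hti
    exact hti.false
  have hlt : ∀ j ∈ s.erase i, ‖t j‖ < ‖t i‖ := by
    intro j hj
    refine (hmax j (Finset.mem_of_mem_erase hj)).lt_of_ne fun heq => ?_
    refine Finset.ne_of_mem_erase hj ?_
    by_cases haj : a j = 0
    · rw [ht j, haj, map_zero, zero_mul, norm_zero] at heq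
      exact absurd heq hti.ne
    refine h j i (a i / a j) (div_ne_zero hai haj) ?_
    have haj' : ‖algebraMap A ℂ_[p] (a j)‖ ≠ 0 := norm_ne_zero_iff.2 (by simpa using haj)
    rw [ht, ht, norm_mul, norm_mul] at heq
    rw [map_div₀, norm_div, div_mul_eq_mul_div, eq_div_iff haj', ← heq, mul_comm]
  rw [← Finset.add_sum_erase s t hi] at hts
  have hnorm : ‖t i‖ = ‖∑ j ∈ s.erase i, t j‖ := by
    rw [eq_neg_of_add_eq_zero_left hts, norm_neg]
  rcases (s.erase i).eq_empty_or_nonempty with h0 | h0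
  · rw [h0, Finset.sum_empty, norm_zero] at hnorm
    exact hti.ne' hnorm
  · obtain ⟨j, hj, hle⟩ := IsUltrametricDist.exists_norm_finsetSum_le_of_nonempty h0 t
    exact ((hlt j hj).trans_le' hle).ne' hnorm

/-- Elements whose norms represent the distinct cosets are linearly independent. A nonzero
`relIndex` means that the index is finite. -/
theorem relIndex_valueGroup_bounds [FiniteDimensional A B] :
    (valueGroup p A).relIndex (valueGroup p B) ≠ 0 ∧
      (valueGroup p A).relIndex (valueGroup p B) ≤ Module.finrank A B := by
  set H := (valueGroup p A).subgroupOf (valueGroup p B)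
  have hex : ∀ c : valueGroup p B ⧸ H, ∃ b : B, b ≠ 0 ∧
      ‖algebraMap B ℂ_[p] b‖ = ((c.out : valueGroup p B) : ℝˣ) := fun c =>
    (mem_valueGroup _).1 c.out.2
  choose b hb0 hb using hex
  have hli : LinearIndependent A b := by
    refine linearIndependent_of_norm_incongruent (p := p) b hb0 fun c c' x hx h => ?_
    rw [hb, hb] at h
    rw [← c.out_eq', ← c'.out_eq']
    refine Eq.symm (QuotientGroup.eq.2 ?_)
    rw [Subgroup.mem_subgroupOf, mem_valueGroup]
    refine ⟨x, hx, ?_⟩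
    rw [Subgroup.coe_mul, Subgroup.coe_inv, Units.val_mul, h, mul_comm, mul_assoc, Units.mul_inv,
      mul_one]
  have hfin : Finite (valueGroup p B ⧸ H) := hli.finite
  have := Fintype.ofFinite (valueGroup p B ⧸ H)
  refine ⟨Nat.card_ne_zero.2 ⟨inferInstance, hfin⟩, ?_⟩
  have := hli.fintype_card_le_finrank
  rwa [← Nat.card_eq_fintype_card] at this

/-- Index and degree are both multiplicative and index ≤ degree in each step, so equality for the
whole tower forces it in the lower step. -/
theorem relIndex_valueGroup_eq_finrank_of_tower {C : Type*} [Field C] [Algebra C ℂ_[p]]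
    [Algebra A C] [Algebra B C] [IsScalarTower A B C] [IsScalarTower B C ℂ_[p]]
    [FiniteDimensional A C]
    (h : Module.finrank A C ≤ (valueGroup p A).relIndex (valueGroup p C)) :
    (valueGroup p A).relIndex (valueGroup p B) = Module.finrank A B := by
  have : FiniteDimensional B C := FiniteDimensional.right A B C
  have : FiniteDimensional A B := FiniteDimensional.left A B C
  obtain ⟨h1, h2⟩ := relIndex_valueGroup_bounds (p := p) (A := A) (B := B)
  obtain ⟨h3, h4⟩ := relIndex_valueGroup_bounds (p := p) (A := B) (B := C)
  rw [← Subgroup.relIndex_mul_relIndex _ _ _ (valueGroup_mono (p := p) (A := A) (B := B))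
    (valueGroup_mono (p := p) (A := B) (B := C)), ← Module.finrank_mul_finrank A B C] at h
  refine h2.antisymm ?_
  by_contra! hlt
  exact (Nat.mul_lt_mul_of_lt_of_le hlt h4 Module.finrank_pos).not_ge h

theorem relIndex_valueGroup_eq_finrank_of_le {M N : IntermediateField K ℂ_[p]} (h : M ≤ N)
    [FiniteDimensional K N]
    (hN : Module.finrank K N ≤ (valueGroup p K).relIndex (valueGroup p N)) :
    (valueGroup p K).relIndex (valueGroup p M) = Module.finrank K M := by
  let : Algebra M N := (IntermediateField.inclusion h).toAlgebra
  have : IsScalarTower K M N := IsScalarTower.of_algebraMap_eq fun _ => rfl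
  have : IsScalarTower M N ℂ_[p] := IsScalarTower.of_algebraMap_eq fun _ => rfl
  exact relIndex_valueGroup_eq_finrank_of_tower hN

end Ramification

/-! ### The field K_∞ and its Galois group -/

theorem mem_torsionPoints_iff (f : (ringOfIntegers p K)⟦X⟧) (u : ℂ_[p]) :
    u ∈ torsionPoints f ↔ ∃ n, u ∈ torsionLevel f (n + 1) := by
  simp only [torsionPoints, Set.mem_iUnion, exists_prop]
  constructor
  · rintro ⟨n, hn, hu⟩
    exact ⟨n - 1, by rwa [Nat.sub_add_cancel hn]⟩
  · rintro ⟨n, hu⟩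
    exact ⟨n + 1, by omega, hu⟩

theorem dist_le_of_pow_dvd_sub {a b : ringOfIntegers p K} {n : ℕ} (h : π ^ n ∣ a - b) :
    dist a b ≤ ‖integerEmbedding K π‖ ^ n := by
  rw [pow_dvd_iff_norm_le, map_sub] at h
  exact (dist_eq_norm (integerEmbedding K a) (integerEmbedding K b)).trans_le h

theorem torsionLevel_subset_torsionField (f : (ringOfIntegers p K)⟦X⟧) {n : ℕ} {u : ℂ_[p]}
    (hu : u ∈ torsionLevel f (n + 1)) : u ∈ torsionField f :=
  IntermediateField.subset_adjoin K _ ((mem_torsionPoints_iff f u).2 ⟨n, hu⟩)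

theorem torsionField_eq_iSup (f : (ringOfIntegers p K)⟦X⟧) :
    torsionField f = ⨆ n : ℕ, IntermediateField.adjoin K (torsionLevel f (n + 1)) := by
  refine le_antisymm ?_ (iSup_le fun n => ?_)
  · rw [torsionField, IntermediateField.adjoin_le_iff]
    intro u hu
    obtain ⟨n, hn⟩ := (mem_torsionPoints_iff f u).1 hu
    exact le_iSup (fun n : ℕ => IntermediateField.adjoin K (torsionLevel f (n + 1))) n
      (IntermediateField.subset_adjoin K _ hn)
  · rw [IntermediateField.adjoin_le_iff]
    exact fun u hu => torsionLevel_subset_torsionField f hu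

namespace IsFullCommutingFamily

variable [FiniteDimensional ℚ_[p] K] (hF : IsFullCommutingFamily π F) (hπ : Irreducible π)
include hF hπ

theorem normal_torsionField : Normal K (torsionField (F π)) := by
  have h (n : ℕ) : Normal K (IntermediateField.adjoin K (torsionLevel (F π) (n + 1))) := by
    have heq : torsionLevel (F π) (n + 1) = (hF.levelPolynomial hπ n).rootSet ℂ_[p] :=
      Set.ext fun u => hF.mem_torsionLevel_iff_mem_rootSet hπ n u
    have := IntermediateField.adjoin_rootSet_isSplittingField
      (IsAlgClosed.splits ((hF.levelPolynomial hπ n).map (algebraMap K ℂ_[p])))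
    rw [heq]
    exact Normal.of_isSplittingField (hF.levelPolynomial hπ n)
  rw [torsionField_eq_iSup]
  exact IntermediateField.normal_iSup (F := K) (K := ℂ_[p]) _

theorem isAlgebraic_torsionField : Algebra.IsAlgebraic K (torsionField (F π)) :=
  (hF.normal_torsionField hπ).toIsAlgebraic

theorem isGalois_torsionField : IsGalois K (torsionField (F π)) :=
  have := hF.normal_torsionField hπ
  have := hF.isAlgebraic_torsionField hπ
  { }

theorem finiteDimensional_adjoin {n : ℕ} {u : ℂ_[p]} (hu : u ∈ torsionLevel (F π) (n + 1)) :
    FiniteDimensional K K⟮u⟯ :=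
  IntermediateField.adjoin.finiteDimensional (hF.isIntegral_of_mem_torsionLevel hπ hu)

/-- An iterate of F_π brings `u` down to level `m + 1`, and a unit moves it to `v`; both series have
values in K(u), which is closed. -/
theorem torsionLevel_subset_adjoin {m n : ℕ} (hmn : m ≤ n) {u v : ℂ_[p]}
    (hu : u ∈ torsionLevel (F π) (n + 1)) (hv : v ∈ torsionLevel (F π) (m + 1)) :
    v ∈ K⟮u⟯ := by
  have := hF.finiteDimensional_adjoin hπ hu
  obtain ⟨k, rfl⟩ := Nat.exists_eq_add_of_le hmn
  have hw := hF.evalAt_iter_mem_torsionLevel hu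
  obtain ⟨α, rfl⟩ := hF.exists_unit_evalAt_eq hπ hw hv
  exact evalAt_mem_of_finiteDimensional _ hw.1 (evalAt_mem_of_finiteDimensional _ hu.1
    (IntermediateField.mem_adjoin_simple_self K u))

theorem algEquiv_mem_torsionLevel (g : Gal((torsionField (F π))/K)) {n : ℕ}
    {u : torsionField (F π)} (hu : (u : ℂ_[p]) ∈ torsionLevel (F π) (n + 1)) :
    ((g u : torsionField (F π)) : ℂ_[p]) ∈ torsionLevel (F π) (n + 1) := by
  have key (x : torsionField (F π)) : Polynomial.aeval (x : ℂ_[p]) (hF.levelPolynomial hπ n) =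
      ((Polynomial.aeval x (hF.levelPolynomial hπ n) : torsionField (F π)) : ℂ_[p]) :=
    Polynomial.aeval_algebraMap_apply ℂ_[p] x _
  rw [hF.mem_torsionLevel_iff_aeval hπ, key, ZeroMemClass.coe_eq_zero] at hu ⊢
  rw [Polynomial.aeval_algEquiv, AlgHom.comp_apply, hu, map_zero]

theorem exists_unit_forall_le (g : Gal((torsionField (F π))/K)) (n : ℕ) :
    ∃ α : (ringOfIntegers p K)ˣ, ∀ m ≤ n, ∀ v : torsionField (F π),
      (v : ℂ_[p]) ∈ torsionLevel (F π) (m + 1) →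
        ((g v : torsionField (F π)) : ℂ_[p]) = evalAt (F α) (v : ℂ_[p]) := by
  have := hF.isAlgebraic_torsionField hπ
  obtain ⟨u, hu⟩ := hF.torsionLevel_nonempty hπ n
  set u' : torsionField (F π) := ⟨u, torsionLevel_subset_torsionField _ hu⟩
  have hu' : (u' : ℂ_[p]) ∈ torsionLevel (F π) (n + 1) := hu
  obtain ⟨α, hα⟩ := hF.exists_unit_evalAt_eq hπ hu' (hF.algEquiv_mem_torsionLevel hπ g hu')
  refine ⟨α, fun m hm v hv => ?_⟩
  obtain ⟨k, rfl⟩ := Nat.exists_eq_add_of_le hm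
  have hw := hF.evalAt_iter_mem_torsionLevel hu
  have h0 := constantCoeff_iter (hF.constantCoeff_eq_zero π) k
  obtain ⟨β, hβ⟩ := hF.exists_unit_evalAt_eq hπ hw hv
  -- Every point of lower level is a series in `u` commuting with F_α, so the action of `g` on `u`
  -- determines that on `v`.
  have hcomp : (v : ℂ_[p]) = evalAt (comp (F β) (iter (F π) k)) (u' : ℂ_[p]) := by
    rw [evalAt_comp _ h0 hu'.1, hβ]
  have hgu := hF.algEquiv_mem_torsionLevel hπ g hu'
  rw [coe_algEquiv_evalAt g _ hu'.1 hcomp, evalAt_comp _ h0 hgu.1, ← hα,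
    hF.evalAt_iter_comm _ _ hu'.1, hF.evalAt_comm _ _ hw.1, hβ]

theorem exists_unit_forall (g : Gal((torsionField (F π))/K)) :
    ∃ α : (ringOfIntegers p K)ˣ, ∀ v : torsionField (F π),
      (v : ℂ_[p]) ∈ torsionPoints (F π) →
        ((g v : torsionField (F π)) : ℂ_[p]) = evalAt (F α) (v : ℂ_[p]) := by
  choose α hα using hF.exists_unit_forall_le hπ g
  have hcauchy {m n : ℕ} (hmn : m ≤ n) :
      π ^ (m + 1) ∣ ((α m : ringOfIntegers p K) - α n) := by
    obtain ⟨u, hu⟩ := hF.torsionLevel_nonempty hπ m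
    refine hF.pow_dvd_sub_of_evalAt_eq hπ hu ?_
    have h (n : ℕ) (hmn : m ≤ n) := hα n m hmn ⟨u, torsionLevel_subset_torsionField _ hu⟩ hu
    exact (h m le_rfl).symm.trans (h n hmn)
  have := isAdicComplete_ringOfIntegers hπ
  obtain ⟨a, ha⟩ := IsPrecomplete.prec (I := IsLocalRing.maximalIdeal (ringOfIntegers p K))
    inferInstance (f := fun n => (α n : ringOfIntegers p K)) fun {m n} hmn => by
      rw [SModEq.sub_mem, smul_eq_mul, Ideal.mul_top, mem_maximalIdeal_pow_iff_dvd hπ]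
      exact (pow_dvd_pow π m.le_succ).trans (hcauchy hmn)
  -- The limit `a` is only known to satisfy `a ≡ α n` mod π^n; passing through `α (n + 1)` gains the
  -- missing factor π.
  have ha' (n : ℕ) : π ^ (n + 1) ∣ (α n : ringOfIntegers p K) - a := by
    have h := ha (n + 1)
    rw [SModEq.sub_mem, smul_eq_mul, Ideal.mul_top, mem_maximalIdeal_pow_iff_dvd hπ] at h
    simpa using dvd_add (hcauchy n.le_succ) h
  have hau : IsUnit a := by
    by_contra hau
    have h := dvd_add ((dvd_pow_self π (Nat.succ_ne_zero 0)).trans (ha' 0))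
      (dvd_of_not_isUnit hπ hau)
    rw [sub_add_cancel] at h
    exact hπ.not_isUnit (isUnit_of_dvd_unit h (α 0).isUnit)
  refine ⟨hau.unit, fun v hv => ?_⟩
  obtain ⟨n, hn⟩ := (mem_torsionPoints_iff _ _).1 hv
  rw [hα n n le_rfl v hn]
  exact (hF.evalAt_eq_iff_pow_dvd_sub hπ (α n).isUnit hau hn).2 (ha' n)

theorem unit_ext {α β : (ringOfIntegers p K)ˣ} (h : ∀ v : torsionField (F π),
    (v : ℂ_[p]) ∈ torsionPoints (F π) → evalAt (F α) (v : ℂ_[p]) = evalAt (F β) (v : ℂ_[p])) :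
    α = β := by
  refine Units.ext (sub_eq_zero.1 (eq_zero_of_forall_pow_dvd hπ fun n => ?_))
  obtain ⟨u, hu⟩ := hF.torsionLevel_nonempty hπ n
  refine (pow_dvd_pow π n.le_succ).trans (hF.pow_dvd_sub_of_evalAt_eq hπ hu ?_)
  exact h ⟨u, torsionLevel_subset_torsionField _ hu⟩ ((mem_torsionPoints_iff _ _).2 ⟨n, hu⟩)

/-! ### The character η -/

/-- The unit `η(g)` with `g(u) = F_{η(g)}(u)` for all `u ∈ Λ_∞`. -/
def character (g : Gal((torsionField (F π))/K)) : (ringOfIntegers p K)ˣ :=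
  (hF.exists_unit_forall hπ g).choose

theorem coe_apply (g : Gal((torsionField (F π))/K)) {v : torsionField (F π)}
    (hv : (v : ℂ_[p]) ∈ torsionPoints (F π)) :
    ((g v : torsionField (F π)) : ℂ_[p]) = evalAt (F (hF.character hπ g)) (v : ℂ_[p]) :=
  (hF.exists_unit_forall hπ g).choose_spec v hv

theorem algEquiv_mem_torsionPoints (g : Gal((torsionField (F π))/K)) {v : torsionField (F π)}
    (hv : (v : ℂ_[p]) ∈ torsionPoints (F π)) :
    ((g v : torsionField (F π)) : ℂ_[p]) ∈ torsionPoints (F π) := by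
  rw [mem_torsionPoints_iff] at hv ⊢
  obtain ⟨n, hn⟩ := hv
  exact ⟨n, hF.algEquiv_mem_torsionLevel hπ g hn⟩

theorem character_mul (g h : Gal((torsionField (F π))/K)) :
    hF.character hπ (g * h) = hF.character hπ g * hF.character hπ h := by
  refine hF.unit_ext hπ fun v hv => ?_
  have hv1 : ‖(v : ℂ_[p])‖ < 1 := ((mem_torsionPoints_iff _ _).1 hv).choose_spec.1
  rw [← hF.coe_apply hπ _ hv, AlgEquiv.mul_apply,
    hF.coe_apply hπ g (hF.algEquiv_mem_torsionPoints hπ h hv), hF.coe_apply hπ h hv,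
    Units.val_mul, hF.evalAt_mul_eq hπ _ _ hv1]

theorem character_injective : Function.Injective (hF.character hπ) := by
  intro g h hgh
  have key : g.toAlgHom = h.toAlgHom := by
    refine IntermediateField.algHom_ext_of_eq_adjoin K (s := torsionPoints (F π)) rfl fun x hx => ?_
    refine Subtype.ext ?_
    have := hF.coe_apply hπ g (v := ⟨x, IntermediateField.subset_adjoin K _ hx⟩) hx
    rw [hgh, ← hF.coe_apply hπ h hx] at this
    exact this
  exact AlgEquiv.ext fun x => DFunLike.congr_fun key x

/-- The character `η` as a homomorphism of groups. -/
def characterHom : Gal((torsionField (F π))/K) →* (ringOfIntegers p K)ˣ :=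
  MonoidHom.mk' (hF.character hπ) (hF.character_mul hπ)

theorem pow_dvd_character_sub {g h : Gal((torsionField (F π))/K)} {n : ℕ} {u : torsionField (F π)}
    (hu : (u : ℂ_[p]) ∈ torsionLevel (F π) (n + 1)) (hgh : g u = h u) :
    π ^ (n + 1) ∣ (hF.character hπ g : ringOfIntegers p K) - hF.character hπ h := by
  have hu' := (mem_torsionPoints_iff _ _).2 ⟨n, hu⟩
  refine hF.pow_dvd_sub_of_evalAt_eq hπ hu ?_
  rw [← hF.coe_apply hπ g hu', ← hF.coe_apply hπ h hu', hgh]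

/-- Automorphisms agreeing on one point of level `n + 1` have characters congruent mod π^{n+1}, and
agreeing with `g` there is an open condition. -/
theorem continuous_coe_character :
    Continuous fun g => (hF.character hπ g : ringOfIntegers p K) := by
  rw [continuous_iff_continuousAt]
  intro g
  rw [ContinuousAt, Metric.tendsto_nhds]
  intro ε hε
  obtain ⟨n, hn⟩ := exists_pow_lt_of_lt_one hε (norm_uniformizer_lt_one hπ)
  obtain ⟨u, hu⟩ := hF.torsionLevel_nonempty hπ n
  set u' : torsionField (F π) := ⟨u, torsionLevel_subset_torsionField _ hu⟩
  have := hF.isAlgebraic_torsionField hπ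
  have : FiniteDimensional K K⟮u'⟯ := IntermediateField.adjoin.finiteDimensional
    (Algebra.IsAlgebraic.isAlgebraic u').isIntegral
  have hopen := (IntermediateField.fixingSubgroup_isOpen K⟮u'⟯).preimage
    (continuous_const_mul g⁻¹)
  filter_upwards [hopen.mem_nhds (x := g) (by simp [one_mem])] with h hh
  have hfix : (g⁻¹ * h) u' = u' :=
    (IntermediateField.mem_fixingSubgroup_iff _ _).1 hh u'
      (IntermediateField.mem_adjoin_simple_self K u')
  have hgh : h u' = g u' := by
    rw [AlgEquiv.mul_apply] at hfix
    conv_rhs => rw [← hfix]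
    rw [← AlgEquiv.mul_apply, mul_inv_cancel]
    rfl
  refine (dist_le_of_pow_dvd_sub ((pow_dvd_pow π n.le_succ).trans
    (hF.pow_dvd_character_sub hπ hu hgh))).trans_lt hn

theorem continuous_characterHom : Continuous (hF.characterHom hπ) := by
  rw [Units.continuous_iff]
  refine ⟨hF.continuous_coe_character hπ, ?_⟩
  -- The unit topology also requires continuity of η(g)⁻¹ = η(g⁻¹).
  refine ((hF.continuous_coe_character hπ).comp continuous_inv).congr fun g => ?_
  exact congrArg Units.val (map_inv (hF.characterHom hπ) g)

/-- The points u and F_α(u) share their minimal polynomial, so normality gives an automorphism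
taking one to the other. -/
theorem exists_pow_dvd_character_sub (α : (ringOfIntegers p K)ˣ) (n : ℕ) :
    ∃ g, π ^ (n + 1) ∣ (hF.character hπ g : ringOfIntegers p K) - α := by
  have := hF.normal_torsionField hπ
  obtain ⟨u, hu⟩ := hF.torsionLevel_nonempty hπ n
  have hv := hF.evalAt_mem_torsionLevel α.isUnit hu
  set u' : torsionField (F π) := ⟨u, torsionLevel_subset_torsionField _ hu⟩
  set v' : torsionField (F π) := ⟨_, torsionLevel_subset_torsionField _ hv⟩
  have hmin : minpoly K u' = minpoly K v' := by
    rw [← minpoly.algebraMap_eq (algebraMap (torsionField (F π)) ℂ_[p]).injective u',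
      ← minpoly.algebraMap_eq (algebraMap (torsionField (F π)) ℂ_[p]).injective v']
    exact (hF.minpoly_eq_levelPolynomial hπ hu).trans (hF.minpoly_eq_levelPolynomial hπ hv).symm
  obtain ⟨g, hg⟩ := minpoly.exists_algEquiv_of_root' (Algebra.IsAlgebraic.isAlgebraic u')
    (show Polynomial.aeval v' (minpoly K u') = 0 by rw [hmin, minpoly.aeval])
  refine ⟨g, hF.pow_dvd_sub_of_evalAt_eq hπ hu ?_⟩
  have := hF.coe_apply hπ g (v := u') ((mem_torsionPoints_iff _ _).2 ⟨n, hu⟩)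
  rw [hg] at this
  exact this.symm

/-- The image is closed, since the Galois group is compact, and dense by the approximation at each
level. -/
theorem character_surjective : Function.Surjective (hF.character hπ) := by
  have := hF.isGalois_torsionField hπ
  intro α
  have hclosed : IsClosed (Set.range fun g => (hF.character hπ g : ringOfIntegers p K)) :=
    (isCompact_range (hF.continuous_coe_character hπ)).isClosed
  suffices h : (α : ringOfIntegers p K) ∈
      Set.range fun g => (hF.character hπ g : ringOfIntegers p K) by
    obtain ⟨g, hg⟩ := h
    exact ⟨g, Units.ext hg⟩
  rw [← hclosed.closure_eq, Metric.mem_closure_range_iff]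
  intro ε hε
  obtain ⟨n, hn⟩ := exists_pow_lt_of_lt_one hε (norm_uniformizer_lt_one hπ)
  obtain ⟨g, hg⟩ := hF.exists_pow_dvd_character_sub hπ α n
  refine ⟨g, ?_⟩
  rw [dist_comm]
  exact (dist_le_of_pow_dvd_sub ((pow_dvd_pow π n.le_succ).trans hg)).trans_lt hn

theorem exists_continuousMulEquiv :
    ∃ η : Gal((torsionField (F π))/K) ≃ₜ* (ringOfIntegers p K)ˣ, ∀ g, η g = hF.character hπ g := by
  have := hF.isGalois_torsionField hπ
  let e : Gal((torsionField (F π))/K) ≃* (ringOfIntegers p K)ˣ :=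
    MulEquiv.ofBijective (hF.characterHom hπ)
      ⟨hF.character_injective hπ, hF.character_surjective hπ⟩
  have he : Continuous e := hF.continuous_characterHom hπ
  exact ⟨{ e with
    continuous_toFun := he
    continuous_invFun := (he.homeoOfEquivCompactToT2 (f := e.toEquiv)).symm.continuous },
    fun g => rfl⟩

theorem isAbelianGalois_torsionField : IsAbelianGalois K (torsionField (F π)) where
  toIsGalois := hF.isGalois_torsionField hπ
  is_comm := ⟨fun g h => hF.character_injective hπ (by
    rw [hF.character_mul, hF.character_mul, mul_comm])⟩

/-! ### Total ramification -/

/-- K_∞ is the increasing union of fields K(u_n) with u_n of level `n + 1`, and `M` is finitely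
generated. -/
theorem exists_le_adjoin (M : IntermediateField K ℂ_[p]) (hM : M ≤ torsionField (F π))
    [FiniteDimensional K M] :
    ∃ (n : ℕ) (u : ℂ_[p]), u ∈ torsionLevel (F π) (n + 1) ∧ M ≤ K⟮u⟯ := by
  choose u hu using hF.torsionLevel_nonempty hπ
  have hle : M ≤ ⨆ n, K⟮u n⟯ := by
    refine hM.trans ?_
    rw [torsionField, IntermediateField.adjoin_le_iff]
    intro v hv
    obtain ⟨n, hn⟩ := (mem_torsionPoints_iff _ _).1 hv
    exact le_iSup (fun n => K⟮u n⟯) n (hF.torsionLevel_subset_adjoin hπ le_rfl (hu n) hn)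
  have hdir : Directed (· ≤ ·) fun n => K⟮u n⟯ := by
    refine directed_of_isDirected_le fun m n hmn => ?_
    rw [IntermediateField.adjoin_simple_le_iff]
    exact hF.torsionLevel_subset_adjoin hπ hmn (hu n) (hu m)
  obtain ⟨S, hS⟩ := IntermediateField.essFiniteType_iff.1
    (inferInstance : Algebra.EssFiniteType K M)
  have hS' : ∃ n, ∀ x ∈ S, x ∈ K⟮u n⟯ := by
    have h (x : ℂ_[p]) (hx : x ∈ S) : ∃ n, x ∈ K⟮u n⟯ := by
      have h1 : x ∈ ⨆ n, K⟮u n⟯ := hle (hS ▸ IntermediateField.subset_adjoin K _ hx)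
      rwa [← SetLike.mem_coe, IntermediateField.coe_iSup_of_directed hdir, Set.mem_iUnion] at h1
    choose! N hN using h
    refine ⟨S.sup N, fun x hx => ?_⟩
    have : K⟮u (N x)⟯ ≤ K⟮u (S.sup N)⟯ := by
      rw [IntermediateField.adjoin_simple_le_iff]
      exact hF.torsionLevel_subset_adjoin hπ (Finset.le_sup hx) (hu _) (hu _)
    exact this (hN x hx)
  obtain ⟨n, hn⟩ := hS'
  refine ⟨n, u n, hu n, ?_⟩
  rw [← hS, IntermediateField.adjoin_le_iff]
  exact hn

/-- The value group of `K` is generated by |π| = |u|^d, with d the level degree, so |u|^m lies in it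
only if d divides m. -/
theorem levelDegree_dvd_relIndex {n : ℕ} {u : ℂ_[p]} (hu : u ∈ torsionLevel (F π) (n + 1)) :
    levelDegree K n ∣ (valueGroup p K).relIndex (valueGroup p K⟮u⟯) := by
  have hd := hF.levelDegree_ne_zero n
  have hnorm := hF.norm_pow_of_mem_torsionLevel hπ hu
  have hpos : 0 < ‖u‖ := by
    rcases (norm_nonneg u).eq_or_lt with h | h
    · rw [← h, zero_pow hd] at hnorm
      exact absurd hnorm (norm_uniformizer_pos hπ).ne
    · exact h
  refine dvd_relIndex_valueGroup (x := IntermediateField.AdjoinSimple.gen K u) ?_ ?_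
  · intro h
    have := congrArg (algebraMap K⟮u⟯ ℂ_[p]) h
    rw [IntermediateField.AdjoinSimple.algebraMap_gen, map_zero] at this
    simp [this] at hpos
  · intro m y hy h
    rw [IntermediateField.AdjoinSimple.algebraMap_gen] at h
    obtain ⟨k, hk⟩ := exists_norm_eq_zpow hπ hy
    have h2 : ‖u‖ ^ (m : ℤ) = ‖u‖ ^ ((levelDegree K n : ℤ) * k) := by
      rw [zpow_natCast, h, zpow_mul, zpow_natCast, hnorm, ← hk]
      rfl
    exact Int.natCast_dvd_natCast.1 ⟨k, zpow_right_injective₀ hpos hu.1.ne h2⟩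

theorem isTotallyRamified_torsionField : IsTotallyRamified (torsionField (F π)) := by
  intro M hM hMfin
  obtain ⟨n, u, hu, hMu⟩ := hF.exists_le_adjoin hπ M hM
  have := hF.finiteDimensional_adjoin hπ hu
  refine relIndex_valueGroup_eq_finrank_of_le hMu ?_
  rw [IntermediateField.adjoin.finrank (hF.isIntegral_of_mem_torsionLevel hπ hu),
    hF.natDegree_minpoly hπ hu]
  exact Nat.le_of_dvd (Nat.pos_of_ne_zero (relIndex_valueGroup_bounds (p := p) (A := K)).1)
    (hF.levelDegree_dvd_relIndex hπ hu)

end IsFullCommutingFamily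

end LubinDynamics

end

theorem mainTheorem2 (p : ℕ) [Fact p.Prime]
    (K : IntermediateField ℚ_[p] ℂ_[p]) [FiniteDimensional ℚ_[p] K]
    (π : LubinDynamics.ringOfIntegers p K) (hπ : Irreducible π)
    (F : LubinDynamics.ringOfIntegers p K → PowerSeries (LubinDynamics.ringOfIntegers p K))
    (hF : LubinDynamics.IsFullCommutingFamily π F) :
    IsAbelianGalois K (LubinDynamics.torsionField (F π)) ∧
    LubinDynamics.IsTotallyRamified (LubinDynamics.torsionField (F π)) ∧
    (∀ g : Gal((LubinDynamics.torsionField (F π))/K),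
      ∃! α : (LubinDynamics.ringOfIntegers p K)ˣ,
        ∀ u : LubinDynamics.torsionField (F π), (u : ℂ_[p]) ∈ LubinDynamics.torsionPoints (F π) →
          ((g u : LubinDynamics.torsionField (F π)) : ℂ_[p]) =
            LubinDynamics.evalAt (F (α : LubinDynamics.ringOfIntegers p K)) (u : ℂ_[p])) ∧
    ∃ η : Gal((LubinDynamics.torsionField (F π))/K) ≃ₜ* (LubinDynamics.ringOfIntegers p K)ˣ,
      ∀ g : Gal((LubinDynamics.torsionField (F π))/K),
        ∀ u : LubinDynamics.torsionField (F π), (u : ℂ_[p]) ∈ LubinDynamics.torsionPoints (F π) →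
          ((g u : LubinDynamics.torsionField (F π)) : ℂ_[p]) =
            LubinDynamics.evalAt (F (η g : LubinDynamics.ringOfIntegers p K)) (u : ℂ_[p]) := by
  refine ⟨hF.isAbelianGalois_torsionField hπ, hF.isTotallyRamified_torsionField hπ, fun g => ?_, ?_⟩
  · obtain ⟨α, hα⟩ := hF.exists_unit_forall hπ g
    exact ⟨α, hα, fun β hβ => hF.unit_ext hπ fun v hv => (hβ v hv).symm.trans (hα v hv)⟩
  · obtain ⟨η, hη⟩ := hF.exists_continuousMulEquiv hπ
    exact ⟨η, fun g u hu => by rw [hη, hF.coe_apply hπ g hu]⟩
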